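/- **Setting.** Let $N^1,N^2$ (goals of the home and away team) be independent Poisson processes with intensities $\mu_1,\mu_2>0$ on a probability space $(\Omega,\mathcal F,\mathbb P)$, with nondecreasing right-continuous paths starting at $0$, and let $(\mathcal F_t)$ be the filtration they generate. The game lasts over $[0,T]$. The traded assets are the bond $B_t=1$ and two stocks $S^i_t=N^i_t+\lambda_i(T-t)$, with constants $\lambda_i>0$, $i=1,2$. Let $\mathbb Q$ be a risk-neutral measure, i.e. a probability measure with the same null sets as $\mathbb P$ under which $S^1,S^2$ are martingales on $[0,T]$. A trading strategy is a predictable process $\phi=(\phi^0,\phi^1,\phi^2)$ with $\int_0^T|\phi^j_s|\,ds<\infty$ almost surely for each $j$; its value is $V^\phi_t=\phi^0_t+\phi^1_tS^1_t+\phi^2_tS^2_t$. It *replicates* a bet $X_T$ if it is self-financing, i.e. almost surely $V^\phi_t=V^\phi_0+\int_0^t\phi^1_s\,dS^1_s+\int_0^t\phi^2_s\,dS^2_s$ for all $t\in[0,T]$ (Lebesgue–Stieltjes integrals), if $V^\phi_T=X_T$ almost surely, and if it is admissible, i.e. $V^\phi$ is a $\mathbb Q$-martingale on $[0,T]$. Let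 $X_T=\Pi(N^1_T,N^2_T)$ be a European bet with payoff $\Pi:\mathbb N\times\mathbb N\to\mathbb R$ that is integrable under $\mathbb Q$. Put $$X(t,k_1,k_2)=\sum_{n_1\ge k_1}\sum_{n_2\ge k_2}\Pi(n_1,n_2)\,p\big(n_1-k_1,\lambda_1(T-t)\big)\,p\big(n_2-k_2,\lambda_2(T-t)\big),\qquad p(n,a)=e^{-a}\frac{a^n}{n!},$$ $\delta_1X(t,k_1,k_2)=X(t,k_1+1,k_2)-X(t,k_1,k_2)$ and $\delta_2X(t,k_1,k_2)=X(t,k_1,k_2+1)-X(t,k_1,k_2)$. **Proposition (portfolio weights).** (a) For every $t\in[0,T]$, the value $\mathbf E^{\mathbb Q}[X_T\mid\mathcal F_t]$ of the bet equals $X(t,N^1_t,N^2_t)$ almost surely. (b) There is a strategy that replicates $X_T$ with $\phi^i_t=\delta_iX(t,N^1_{t-},N^2_{t-})$ for $i=1,2$ and all $t\in(0,T]$. (c) For every strategy $\phi$ that replicates $X_T$ and for $i=1,2$, almost surely $$\phi^i_t=\delta_iX(t,N^1_t,N^2_t)\quad\text{for Lebesgue-almost every }t\in[0,T],$$ and almost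 surely $\phi^i_t=\delta_iX(t,N^1_{t-},N^2_{t-})$ at every time $t\in(0,T]$ at which team $i$ scores. -/

import Mathlib

open MeasureTheory ProbabilityTheory Filter Set
open scoped NNReal ENNReal

noncomputable section

/-- Lebesgue measure on the time axis `[0, ∞)`. -/
def timeMeasure : Measure ℝ≥0 := Measure.comap ((↑) : ℝ≥0 → ℝ) volume

/-- `N` is a (homogeneous) Poisson process of intensity `μ` under `P`: a counting process
(started at `0`, with nondecreasing right-continuous paths) with independent increments, such that
`N t - N s` is Poisson distributed with parameter `μ (t - s)` for `s ≤ t`. -/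
structure IsPoissonProcess {Ω : Type*} [MeasurableSpace Ω]
    (N : ℝ≥0 → Ω → ℕ) (μ : ℝ≥0) (P : Measure Ω) : Prop where
  measurable : ∀ t, Measurable (N t)
  zero : ∀ ω, N 0 ω = 0
  mono : ∀ ω, Monotone fun t => N t ω
  right_continuous : ∀ ω t, ContinuousWithinAt (fun s => N s ω) (Ici t) t
  indep_increments : HasIndepIncrements N P
  law_increment : ∀ s t, s ≤ t → HasLaw (fun ω => N t ω - N s ω) (poissonMeasure (μ * (t - s))) P

/-- The market: the scores `N 0` (home team) and `N 1` (away team) are independent Poisson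
processes with intensities `μ 0`, `μ 1` under the physical measure `P`; the game ends at time `T`;
`lam 0`, `lam 1` are the constants in the price dynamics of the two stocks. -/
structure BettingMarket {Ω : Type*} [MeasurableSpace Ω] (P : Measure Ω) where
  N : Fin 2 → ℝ≥0 → Ω → ℕ
  μ : Fin 2 → ℝ≥0
  lam : Fin 2 → ℝ≥0
  T : ℝ≥0
  μ_pos : ∀ i, 0 < μ i
  lam_pos : ∀ i, 0 < lam i
  poisson : ∀ i, IsPoissonProcess (N i) (μ i) P
  indep : IndepFun (fun ω t => N 0 t ω) (fun ω t => N 1 t ω) P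

namespace BettingMarket

variable {Ω : Type*} [MeasurableSpace Ω] {P : Measure Ω} (M : BettingMarket P)

/-- The current score `(N 0 t, N 1 t)`. -/
def score (t : ℝ≥0) (ω : Ω) : Fin 2 → ℕ := fun i => M.N i t ω

/-- The score immediately before time `t`, i.e. `(N 0 (t-), N 1 (t-))`. -/
def scoreBefore (t : ℝ≥0) (ω : Ω) : Fin 2 → ℕ :=
  fun i => Function.leftLim (fun s => M.N i s ω) t

/-- Team `i` scores at time `t`. -/
def IsGoalTime (i : Fin 2) (t : ℝ≥0) (ω : Ω) : Prop :=
  M.score t ω i ≠ M.scoreBefore t ω i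

theorem stronglyMeasurable_score (t : ℝ≥0) : StronglyMeasurable (M.score t) :=
  (measurable_pi_lambda _ fun i => (M.poisson i).measurable t).stronglyMeasurable

/-- The filtration generated by the two score processes. -/
def filtration : Filtration ℝ≥0 (inferInstance : MeasurableSpace Ω) :=
  Filtration.natural M.score M.stronglyMeasurable_score

/-- The price `S i t = N i t + lam i * (T - t)` of stock `i` (for `t ≤ T`). -/
def stock (i : Fin 2) (t : ℝ≥0) (ω : Ω) : ℝ :=
  M.N i t ω + M.lam i * ((M.T : ℝ) - t)

/-- The path `t ↦ N i t ω` as a Stieltjes function. -/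
def path (i : Fin 2) (ω : Ω) : StieltjesFunction ℝ≥0 where
  toFun t := M.N i t ω
  mono' _ _ h := Nat.cast_le.2 ((M.poisson i).mono ω h)
  right_continuous' t :=
    continuous_of_discreteTopology.continuousAt.comp_continuousWithinAt
      ((M.poisson i).right_continuous ω t)

/-- The Lebesgue–Stieltjes integral `∫_{(0, t]} f s dS i s` along the path `ω`, where
`dS i = dN i - lam i dt`. -/
def stockIntegral (i : Fin 2) (f : ℝ≥0 → ℝ) (t : ℝ≥0) (ω : Ω) : ℝ :=
  (∫ s in Ioc 0 t, f s ∂(M.path i ω).measure) - M.lam i * ∫ s in Ioc 0 t, f s ∂timeMeasure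

/-- `Y` is a `Q`-martingale on the time interval `[0, T]` (that is, `Y` stopped at `T` is a
martingale) for the filtration generated by the scores. -/
def IsMartingaleOnGame (Y : ℝ≥0 → Ω → ℝ) (Q : Measure Ω) : Prop :=
  Martingale (fun t => Y (min t M.T)) M.filtration Q

/-- `Q` is a risk-neutral (equivalent martingale) measure: a probability measure with the same null
sets as `P` under which the prices of both stocks are martingales on `[0, T]`
(the bond price is constantly `1`). -/
structure IsRiskNeutral (Q : Measure Ω) : Prop where
  prob : IsProbabilityMeasure Q
  abs_cont : Q ≪ P
  abs_cont' : P ≪ Q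
  martingale_stock : ∀ i, M.IsMartingaleOnGame (M.stock i) Q

/-- A trading strategy `φ = (φ 0, φ 1, φ 2)`: predictable holdings of the bond (`φ 0`) and of the
two stocks (`φ 1`, `φ 2`), integrable in time on `[0, T]` along almost every path. -/
structure IsTradingStrategy (φ : Fin 3 → ℝ≥0 → Ω → ℝ) : Prop where
  predictable : ∀ j, IsStronglyPredictable M.filtration (φ j)
  integrable : ∀ j, ∀ᵐ ω ∂P, IntegrableOn (fun t => φ j t ω) (Iic M.T) timeMeasure

/-- The value `V t = φ 0 t * B t + φ 1 t * S 0 t + φ 2 t * S 1 t` of a strategy, with `B t = 1`. -/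
def value (φ : Fin 3 → ℝ≥0 → Ω → ℝ) (t : ℝ≥0) (ω : Ω) : ℝ :=
  φ 0 t ω * 1 + φ 1 t ω * M.stock 0 t ω + φ 2 t ω * M.stock 1 t ω

/-- The strategy is self-financing on `[0, T]`. -/
def IsSelfFinancing (φ : Fin 3 → ℝ≥0 → Ω → ℝ) : Prop :=
  ∀ᵐ ω ∂P, ∀ t ≤ M.T,
    M.value φ t ω = M.value φ 0 ω + M.stockIntegral 0 (fun s => φ 1 s ω) t ω
      + M.stockIntegral 1 (fun s => φ 2 s ω) t ω

/-- `φ` replicates the bet `X`: it is a self-financing trading strategy with terminal value `X`,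
and it is admissible, i.e. its value process is a martingale under the risk-neutral measure `Q`. -/
structure Replicates (Q : Measure Ω) (φ : Fin 3 → ℝ≥0 → Ω → ℝ) (X : Ω → ℝ) : Prop where
  strategy : M.IsTradingStrategy φ
  selfFinancing : M.IsSelfFinancing φ
  martingale : M.IsMartingaleOnGame (M.value φ) Q
  terminal : M.value φ M.T =ᵐ[P] X

/-- The European bet with payoff function `pay`. -/
def europeanBet (pay : ℕ → ℕ → ℝ) (ω : Ω) : ℝ := pay (M.N 0 M.T ω) (M.N 1 M.T ω)

/-- The Poisson probability `exp (-a) * a ^ n / n!`. -/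
def poissonProb (n : ℕ) (a : ℝ) : ℝ := Real.exp (-a) / n.factorial * a ^ n

/-- The value `X(t, k 0, k 1)` of the European bet at time `t` when the current score is `k`:
the sum over `n₁ ≥ k 0`, `n₂ ≥ k 1` of
`pay n₁ n₂ * P(n₁ - k 0, lam 0 (T - t)) * P(n₂ - k 1, lam 1 (T - t))`, with `nᵢ = k + jᵢ`. -/
def europeanValue (pay : ℕ → ℕ → ℝ) (t : ℝ≥0) (k : Fin 2 → ℕ) : ℝ :=
  ∑' j₁ : ℕ, ∑' j₂ : ℕ, pay (k 0 + j₁) (k 1 + j₂)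
    * poissonProb j₁ (M.lam 0 * ((M.T : ℝ) - t)) * poissonProb j₂ (M.lam 1 * ((M.T : ℝ) - t))

/-- The forward difference `δ i` of a function of the score: one more goal for team `i`. -/
def forwardDiff (i : Fin 2) (g : (Fin 2 → ℕ) → ℝ) (k : Fin 2 → ℕ) : ℝ :=
  g (k + Pi.single i 1) - g k

end BettingMarket

end

/-! ### Lebesgue measure on the time axis and integration of series. -/

open scoped Topology

/-! The proof combines a pathwise change of variables with the compensators of the goal counts. For
a fixed final score, the Poisson weights `trans` solve the backward Kolmogorov equation. Summed
against the payoff, this says that while the score stands still the value drifts at rate `-λ₁ δ₁X -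
λ₂ δ₂X` (`HasValue.scoreValue_sub`), and a goal of team `i` moves it by `δᵢX`. Almost surely goals
come one at a time (`ae_isSimple`), so adding up drifts and jumps gives `X(t, N_t) = X(0, 0) + Σᵢ ∫
δᵢX(s, N_{s-}) dSⁱ` (`HasValue.scoreValue_eq`).

Nothing is assumed about the law of the scores under `Q`. The martingale property of the stocks says
that `dNⁱ dQ` and `λᵢ dt dQ` agree on the rectangles generating the predictable sets, hence on all
predictable sets (`trim_goalMeasure`), so bounded predictable positions have zero expected gain. For
the bet paying `1` on a single final score, whose price lies in `[0, 1]`, this identifies the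
conditional probability of that score with `trans`. Summing over final scores gives (a),
integrability of the bet providing absolute convergence. For (b), hold `δᵢX(t, N_{t-})` stocks and
the rest in bonds: the pathwise formula makes this self-financing, and (a) makes it admissible.

For (c), admissibility forces two replicating strategies to have the same value at each time almost
surely. The difference of their gains then vanishes on a dense set of times. Its `dt`-part is
continuous, so its jumps vanish, and at a goal of team `i` the jump is the difference of the
holdings of stock `i`. Thus the holdings agree `dNⁱ`-almost everywhere, and the compensator carries
this over to `dt`. -/

theorem measurableEmbedding_nnreal_coe : MeasurableEmbedding ((↑) : ℝ≥0 → ℝ) :=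
  MeasurableEmbedding.subtype_coe measurableSet_Ici

theorem nnreal_coe_image_Ioc (u t : ℝ≥0) : ((↑) : ℝ≥0 → ℝ) '' Ioc u t = Ioc (u : ℝ) t := by
  ext x
  constructor
  · rintro ⟨y, hy, rfl⟩
    exact ⟨NNReal.coe_lt_coe.2 hy.1, NNReal.coe_le_coe.2 hy.2⟩
  · rintro ⟨h1, h2⟩
    have hx : 0 ≤ x := u.2.trans h1.le
    exact ⟨⟨x, hx⟩, ⟨NNReal.coe_lt_coe.1 h1, NNReal.coe_le_coe.1 h2⟩, rfl⟩

theorem timeMeasure_apply (s : Set ℝ≥0) : timeMeasure s = volume (((↑) : ℝ≥0 → ℝ) '' s) :=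
  measurableEmbedding_nnreal_coe.comap_apply _ _

theorem timeMeasure_Ioc (u t : ℝ≥0) : timeMeasure (Ioc u t) = ENNReal.ofReal ((t : ℝ) - u) := by
  rw [timeMeasure_apply, nnreal_coe_image_Ioc, Real.volume_Ioc]

theorem timeMeasure_singleton (t : ℝ≥0) : timeMeasure {t} = 0 := by
  simp [timeMeasure_apply]

instance nullSingletonClass_timeMeasure : NullSingletonClass timeMeasure := ⟨timeMeasure_singleton⟩

theorem timeMeasure_Iic (t : ℝ≥0) : timeMeasure (Iic t) = ENNReal.ofReal t := by
  have : Iic t = Icc 0 t := by ext; simp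
  rw [this, ← measure_congr Ioc_ae_eq_Icc, timeMeasure_Ioc]
  simp

instance isFiniteMeasureOnCompacts_timeMeasure : IsFiniteMeasureOnCompacts timeMeasure where
  lt_top_of_isCompact K hK := by
    obtain ⟨b, hb⟩ := hK.bddAbove
    exact (measure_mono (t := Iic b) fun x hx => hb hx).trans_lt
      (timeMeasure_Iic b ▸ ENNReal.ofReal_lt_top)

theorem setIntegral_timeMeasure_Ioc (f : ℝ → ℝ) {u t : ℝ≥0} (h : u ≤ t) :
    ∫ s in Ioc u t, f s ∂timeMeasure = ∫ s in (u : ℝ)..t, f s := by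
  have h1 := measurableEmbedding_nnreal_coe.setIntegral_map (μ := timeMeasure) f (Ioc (u : ℝ) t)
  rw [intervalIntegral.integral_of_le (NNReal.coe_le_coe.2 h)]
  have h2 : ((↑) : ℝ≥0 → ℝ) ⁻¹' Ioc (u : ℝ) t = Ioc u t := by ext; simp
  rw [h2] at h1
  rw [← h1, timeMeasure, measurableEmbedding_nnreal_coe.map_comap, Measure.restrict_restrict
    measurableSet_Ioc]
  congr 2
  rw [inter_eq_left]
  intro x hx
  exact ⟨⟨x, u.2.trans hx.1.le⟩, rfl⟩

theorem setIntegral_timeMeasure_deriv {F F' : ℝ → ℝ} (hF : ∀ x, HasDerivAt F (F' x) x)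
    (hF' : Continuous F') {u t : ℝ≥0} (h : u ≤ t) :
    ∫ s in Ioc u t, F' s ∂timeMeasure = F t - F u := by
  rw [setIntegral_timeMeasure_Ioc F' h]
  exact intervalIntegral.integral_eq_sub_of_hasDerivAt (fun x _ => hF x)
    (hF'.intervalIntegrable _ _)

theorem integrableOn_timeMeasure_Ioc {f : ℝ≥0 → ℝ} {u t : ℝ≥0} (hf : ContinuousOn f (Icc u t)) :
    IntegrableOn f (Ioc u t) timeMeasure :=
  (hf.integrableOn_compact isCompact_Icc).mono_set Ioc_subset_Icc_self

theorem integral_enorm_summable {α ι : Type*} [MeasurableSpace α] {μ : Measure α} [Countable ι]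
    {F : ι → α → ℝ} (hF : ∀ i, Integrable (F i) μ) (hs : Summable fun i => ∫ a, ‖F i a‖ ∂μ) :
    ∫⁻ a, ∑' i, ‖F i a‖ₑ ∂μ < ∞ := by
  rw [lintegral_tsum fun i => (hF i).1.enorm]
  have : ∀ i, ∫⁻ a, ‖F i a‖ₑ ∂μ = ENNReal.ofReal (∫ a, ‖F i a‖ ∂μ) := fun i => by
    rw [ofReal_integral_norm_eq_lintegral_enorm (hF i)]
  simp_rw [this]
  rw [← ENNReal.ofReal_tsum_of_nonneg (fun i => integral_nonneg fun a => norm_nonneg _) hs]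
  exact ENNReal.ofReal_lt_top

/-- Tonelli: the sum of the norms has finite integral. This later extracts convergence at some time
from convergence of time integrals. -/
theorem ae_summable_norm_of_summable_integral {α ι : Type*} [MeasurableSpace α] {μ : Measure α}
    [Countable ι] {F : ι → α → ℝ} (hF : ∀ i, Integrable (F i) μ)
    (hs : Summable fun i => ∫ a, ‖F i a‖ ∂μ) : ∀ᵐ a ∂μ, Summable fun i => ‖F i a‖ := by
  have h := integral_enorm_summable hF hs
  filter_upwards [ae_lt_top' (AEMeasurable.tsum fun i => (hF i).1.enorm) h.ne] with a ha
  exact tsum_enorm_ne_top_iff_summable_norm.1 ha.ne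

theorem integrable_tsum_of_summable_integral {α ι : Type*} [MeasurableSpace α] {μ : Measure α}
    [Countable ι] {F : ι → α → ℝ} (hF : ∀ i, Integrable (F i) μ)
    (hs : Summable fun i => ∫ a, ‖F i a‖ ∂μ) : Integrable (fun a => ∑' i, F i a) μ := by
  have hae := ae_summable_norm_of_summable_integral hF hs
  refine ⟨?_, ?_⟩
  · refine aestronglyMeasurable_of_tendsto_ae (atTop : Filter (Finset ι))
      (f := fun s a => ∑ i ∈ s, F i a)
      (fun s => Finset.aestronglyMeasurable_fun_sum s fun i _ => (hF i).1) ?_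
    filter_upwards [hae] with a ha using ha.of_norm.hasSum
  · refine lt_of_le_of_lt (lintegral_mono_ae ?_) (integral_enorm_summable hF hs)
    filter_upwards [hae] with a ha using enorm_tsum_le_tsum_enorm

/-! ### Poisson transition probabilities and the backward equation. -/

namespace BettingMarket

/-- The probability that a Poisson process at level `k` is at level `n` after an increment of
parameter `a`. -/
noncomputable def poissonShift (k n : ℕ) (a : ℝ) : ℝ := if k ≤ n then poissonProb (n - k) a else 0

theorem poissonProb_zero_right (n : ℕ) : poissonProb n 0 = if n = 0 then 1 else 0 := by
  rcases n with _ | n <;> simp [poissonProb]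

theorem hasDerivAt_poissonProb_zero (a : ℝ) :
    HasDerivAt (poissonProb 0) (-poissonProb 0 a) a := by
  have h : HasDerivAt (fun a : ℝ => Real.exp (-a)) (Real.exp (-a) * -1) a :=
    (hasDerivAt_id a).neg.exp
  have e : poissonProb 0 = fun a : ℝ => Real.exp (-a) := by ext; simp [poissonProb]
  rw [e]
  simpa using h

theorem hasDerivAt_poissonProb_succ (n : ℕ) (a : ℝ) :
    HasDerivAt (poissonProb (n + 1)) (poissonProb n a - poissonProb (n + 1) a) a := by
  have h : HasDerivAt (fun a : ℝ => Real.exp (-a)) (Real.exp (-a) * -1) a :=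
    (hasDerivAt_id a).neg.exp
  have h2 := (h.div_const ((n + 1).factorial : ℝ)).mul (hasDerivAt_pow (n + 1) a)
  refine h2.congr_deriv ?_
  simp only [poissonProb, Nat.factorial_succ]
  have : (n.factorial : ℝ) ≠ 0 := by positivity
  push_cast
  field_simp
  ring

/-- The convention that the weight is `0` for `n < k` lets a single formula, a forward difference in
the starting level, cover the boundary cases. -/
theorem hasDerivAt_poissonShift (k n : ℕ) (a : ℝ) :
    HasDerivAt (poissonShift k n) (poissonShift (k + 1) n a - poissonShift k n a) a := by
  rcases lt_trichotomy n k with h | h | h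
  · have e : poissonShift k n = fun _ => 0 := by ext; simp [poissonShift, h.not_ge]
    simpa [e, poissonShift, (show ¬ k + 1 ≤ n by omega), h.not_ge] using hasDerivAt_const a (0 : ℝ)
  · subst h
    have e : poissonShift n n = poissonProb 0 := by ext; simp [poissonShift]
    simpa [e, poissonShift] using hasDerivAt_poissonProb_zero a
  · obtain ⟨m, rfl⟩ := Nat.exists_eq_add_of_lt h
    have e : poissonShift k (k + m + 1) = poissonProb (m + 1) := by
      ext; simp [poissonShift, show k ≤ k + m + 1 by omega, show k + m + 1 - k = m + 1 by omega]
    have e' : poissonShift (k + 1) (k + m + 1) a = poissonProb m a := by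
      simp [poissonShift, show k + m + 1 - (k + 1) = m by omega]
    rw [e, e']
    exact hasDerivAt_poissonProb_succ m a

theorem poissonShift_nonneg (k n : ℕ) {a : ℝ} (ha : 0 ≤ a) : 0 ≤ poissonShift k n a := by
  unfold poissonShift poissonProb
  split_ifs <;> positivity

/-- Only the exponential factor decreases in the parameter, since `a ^ m ≤ b ^ m`. The constant does
not depend on `n`, so convergence of the value series at one time dominates all later times. -/
theorem poissonShift_le_exp_mul (k n : ℕ) {a b : ℝ} (ha : 0 ≤ a) (hab : a ≤ b) :
    poissonShift k n a ≤ Real.exp (b - a) * poissonShift k n b := by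
  unfold poissonShift poissonProb
  split_ifs with h
  · have : Real.exp (-a) = Real.exp (b - a) * Real.exp (-b) := by
      rw [← Real.exp_add]; congr 1; ring
    rw [this, ← mul_assoc, mul_div_assoc]
    gcongr
  · simp

theorem poissonShift_zero_right (k n : ℕ) : poissonShift k n 0 = if n = k then 1 else 0 := by
  unfold poissonShift
  rw [poissonProb_zero_right]
  split_ifs <;> first | rfl | omega

variable {Ω : Type*} [MeasurableSpace Ω] {P : Measure Ω} (M : BettingMarket P)

/-- The risk-neutral probability that the final score is `n` if the score at time `t` is `k`. -/
noncomputable def trans (k : Fin 2 → ℕ) (n : ℕ × ℕ) (t : ℝ) : ℝ :=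
  poissonShift (k 0) n.1 (M.lam 0 * (M.T - t)) * poissonShift (k 1) n.2 (M.lam 1 * (M.T - t))

/-- The generator of the pair of Poisson processes with intensities `lam i`. -/
noncomputable def generator (g : (Fin 2 → ℕ) → ℝ) (k : Fin 2 → ℕ) : ℝ :=
  M.lam 0 * forwardDiff 0 g k + M.lam 1 * forwardDiff 1 g k

theorem hasDerivAt_trans (k : Fin 2 → ℕ) (n : ℕ × ℕ) (t : ℝ) :
    HasDerivAt (M.trans k n) (-M.generator (fun l => M.trans l n t) k) t := by
  have hl : ∀ i : Fin 2, HasDerivAt (fun t : ℝ => (M.lam i : ℝ) * (M.T - t)) (-(M.lam i)) t := by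
    intro i
    simpa using ((hasDerivAt_id t).const_sub (M.T : ℝ)).const_mul (M.lam i : ℝ)
  have h := ((hasDerivAt_poissonShift (k 0) n.1 _).comp t (hl 0)).mul
    ((hasDerivAt_poissonShift (k 1) n.2 _).comp t (hl 1))
  refine h.congr_deriv ?_
  simp [generator, forwardDiff, trans]
  ring

theorem continuous_trans (k : Fin 2 → ℕ) (n : ℕ × ℕ) : Continuous (M.trans k n) :=
  continuous_iff_continuousAt.2 fun a => (M.hasDerivAt_trans k n a).continuousAt

theorem lam_mul_nonneg (i : Fin 2) {t : ℝ} (ht : t ≤ M.T) : 0 ≤ (M.lam i : ℝ) * (M.T - t) :=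
  mul_nonneg (M.lam i).2 (sub_nonneg.2 ht)

theorem trans_nonneg (k : Fin 2 → ℕ) (n : ℕ × ℕ) {t : ℝ} (ht : t ≤ M.T) : 0 ≤ M.trans k n t :=
  mul_nonneg (poissonShift_nonneg _ _ (M.lam_mul_nonneg 0 ht))
    (poissonShift_nonneg _ _ (M.lam_mul_nonneg 1 ht))

theorem trans_le_exp_mul (k : Fin 2 → ℕ) (n : ℕ × ℕ) {u t : ℝ} (hut : u ≤ t) (ht : t ≤ M.T) :
    M.trans k n t ≤ Real.exp ((M.lam 0 + M.lam 1) * (t - u)) * M.trans k n u := by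
  have h : ∀ i : Fin 2, (M.lam i : ℝ) * (M.T - t) ≤ M.lam i * (M.T - u) := fun i =>
    mul_le_mul_of_nonneg_left (by linarith) (M.lam i).2
  have h0 := poissonShift_le_exp_mul (k 0) n.1 (M.lam_mul_nonneg 0 ht) (h 0)
  have h1 := poissonShift_le_exp_mul (k 1) n.2 (M.lam_mul_nonneg 1 ht) (h 1)
  refine (mul_le_mul h0 h1 (poissonShift_nonneg _ _ (M.lam_mul_nonneg 1 ht))
    (mul_nonneg (Real.exp_pos _).le
      (poissonShift_nonneg _ _ (M.lam_mul_nonneg 0 (hut.trans ht))))).trans_eq ?_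
  rw [mul_mul_mul_comm, ← Real.exp_add, trans]
  congr 2
  ring

theorem trans_T (k : Fin 2 → ℕ) (n : ℕ × ℕ) :
    M.trans k n M.T = if n = (k 0, k 1) then 1 else 0 := by
  rw [trans, sub_self, mul_zero, mul_zero, poissonShift_zero_right, poissonShift_zero_right]
  by_cases h0 : n.1 = k 0 <;> by_cases h1 : n.2 = k 1 <;> simp [h0, h1, Prod.ext_iff]

end BettingMarket

/-! ### Convergence of the value series and the Kolmogorov equation for the value. -/

namespace BettingMarket

variable {Ω : Type*} [MeasurableSpace Ω] {P : Measure Ω} (M : BettingMarket P)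

/-- The series of the value of the bet is absolutely convergent at time `t` and score `k`. -/
def HasValue (pay : ℕ → ℕ → ℝ) (t : ℝ≥0) (k : Fin 2 → ℕ) : Prop :=
  Summable fun n : ℕ × ℕ => pay n.1 n.2 * M.trans k n t

/-- The value of the bet as a sum over the final scores. -/
noncomputable def scoreValue (pay : ℕ → ℕ → ℝ) (t : ℝ≥0) (k : Fin 2 → ℕ) : ℝ :=
  ∑' n : ℕ × ℕ, pay n.1 n.2 * M.trans k n t

variable {M} {pay : ℕ → ℕ → ℝ} {u t : ℝ≥0} {k : Fin 2 → ℕ}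

theorem norm_mul_trans_le (hut : u ≤ t) (ht : t ≤ M.T) (n : ℕ × ℕ) :
    ‖pay n.1 n.2 * M.trans k n t‖ ≤
      Real.exp ((M.lam 0 + M.lam 1) * (t - u)) * ‖pay n.1 n.2 * M.trans k n u‖ := by
  have ht' : (t : ℝ) ≤ M.T := ht
  have hut' : (u : ℝ) ≤ t := hut
  rw [norm_mul, norm_mul, Real.norm_of_nonneg (M.trans_nonneg k n ht'),
    Real.norm_of_nonneg (M.trans_nonneg k n (hut'.trans ht')), mul_left_comm]
  exact mul_le_mul_of_nonneg_left (M.trans_le_exp_mul k n hut' ht') (norm_nonneg _)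

theorem HasValue.mono (h : M.HasValue pay u k) (hut : u ≤ t) (ht : t ≤ M.T) :
    M.HasValue pay t k :=
  Summable.of_norm_bounded (h.norm.mul_left _) fun n => norm_mul_trans_le hut ht n

theorem integrableOn_mul_trans (n : ℕ × ℕ) :
    IntegrableOn (fun s : ℝ≥0 => pay n.1 n.2 * M.trans k n s) (Ioc u t) timeMeasure :=
  integrableOn_timeMeasure_Ioc (by have := M.continuous_trans k n; fun_prop)

theorem integral_generator_trans (k : Fin 2 → ℕ) (n : ℕ × ℕ) (hut : u ≤ t) :
    ∫ s in Ioc u t, M.generator (fun l => M.trans l n s) k ∂timeMeasure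
      = M.trans k n u - M.trans k n t := by
  have h := setIntegral_timeMeasure_deriv (F := fun t => -M.trans k n t)
    (F' := fun s => M.generator (fun l => M.trans l n s) k)
    (fun x => by simpa using (M.hasDerivAt_trans k n x).fun_neg)
    (by
      have := fun l => M.continuous_trans l n
      unfold generator forwardDiff
      fun_prop) hut
  rw [h]
  ring

theorem integrableOn_trans (k : Fin 2 → ℕ) (n : ℕ × ℕ) :
    IntegrableOn (fun s : ℝ≥0 => M.trans k n s) (Ioc u t) timeMeasure :=
  integrableOn_timeMeasure_Ioc (by have := M.continuous_trans k n; fun_prop)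

theorem integral_generator_trans_eq (k : Fin 2 → ℕ) (n : ℕ × ℕ) :
    ∫ s in Ioc u t, M.generator (fun l => M.trans l n s) k ∂timeMeasure
      = M.lam 0 * ((∫ s in Ioc u t, M.trans (k + Pi.single 0 1) n s ∂timeMeasure)
          - ∫ s in Ioc u t, M.trans k n s ∂timeMeasure)
        + M.lam 1 * ((∫ s in Ioc u t, M.trans (k + Pi.single 1 1) n s ∂timeMeasure)
          - ∫ s in Ioc u t, M.trans k n s ∂timeMeasure) := by
  have hi : ∀ l, IntegrableOn (fun s : ℝ≥0 => M.trans l n s) (Ioc u t) timeMeasure :=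
    fun l => integrableOn_trans l n
  have hd : ∀ i, IntegrableOn (fun s : ℝ≥0 => forwardDiff i (fun l => M.trans l n s) k)
      (Ioc u t) timeMeasure := fun i => (hi _).sub (hi _)
  unfold generator
  rw [integral_add ((hd 0).const_mul _) ((hd 1).const_mul _), integral_const_mul,
    integral_const_mul]
  unfold forwardDiff
  rw [integral_sub (hi _) (hi _), integral_sub (hi _) (hi _)]

theorem integral_trans_nonneg (k : Fin 2 → ℕ) (n : ℕ × ℕ) (ht : t ≤ M.T) :
    0 ≤ ∫ s in Ioc u t, M.trans k n s ∂timeMeasure :=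
  setIntegral_nonneg measurableSet_Ioc fun _ hs =>
    M.trans_nonneg k n (NNReal.coe_le_coe.2 (hs.2.trans ht))

theorem integral_trans_le (k : Fin 2 → ℕ) (n : ℕ × ℕ) (hut : u ≤ t) (ht : t ≤ M.T) :
    ∫ s in Ioc u t, M.trans k n s ∂timeMeasure ≤
      (t - u) * Real.exp ((M.lam 0 + M.lam 1) * (t - u)) * M.trans k n u := by
  have hut' : (u : ℝ) ≤ t := hut
  have h : ∀ s ∈ Ioc u t, M.trans k n s ≤
      Real.exp ((M.lam 0 + M.lam 1) * (t - u)) * M.trans k n u := by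
    intro s hs
    have hs1 : (u : ℝ) ≤ s := NNReal.coe_le_coe.2 hs.1.le
    have hs2 : (s : ℝ) ≤ t := hs.2
    have hT : (s : ℝ) ≤ M.T := hs2.trans ht
    refine (M.trans_le_exp_mul k n hs1 hT).trans ?_
    refine mul_le_mul_of_nonneg_right (Real.exp_le_exp.2 ?_) (M.trans_nonneg k n (hs1.trans hT))
    exact mul_le_mul_of_nonneg_left (by linarith) (add_nonneg (M.lam 0).2 (M.lam 1).2)
  refine (setIntegral_mono_on (integrableOn_trans k n)
    (integrableOn_const (by simp [timeMeasure_Ioc])) measurableSet_Ioc h).trans_eq ?_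
  rw [setIntegral_const, smul_eq_mul, Measure.real, timeMeasure_Ioc,
    ENNReal.toReal_ofReal (sub_nonneg.2 hut'), mul_assoc]

/-- Solve the integrated Kolmogorov equation for the term with one more goal of team `i`, and drop
the nonnegative term of the other team and the weight at `t`. The factor is uniform in `n`, so the
series at score `k` controls the time integral of the series at `k + Pi.single i 1`. -/
theorem integral_trans_add_single_le (k : Fin 2 → ℕ) (n : ℕ × ℕ) (hut : u ≤ t) (ht : t ≤ M.T)
    (i : Fin 2) :
    ∫ s in Ioc u t, M.trans (k + Pi.single i 1) n s ∂timeMeasure ≤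
      (M.lam i : ℝ)⁻¹ * (1 + (M.lam 0 + M.lam 1) * ((t - u)
        * Real.exp ((M.lam 0 + M.lam 1) * (t - u)))) * M.trans k n u := by
  have h1 := integral_generator_trans (M := M) k n hut
  rw [integral_generator_trans_eq] at h1
  have h2 := integral_trans_le (M := M) k n hut ht
  have h3 := M.trans_nonneg k n (t := t) ht
  have hp := fun i => NNReal.coe_pos.2 (M.lam_pos i)
  have hn := fun i => integral_trans_nonneg (M := M) (u := u) (k + Pi.single i 1) n ht
  have h4 := mul_le_mul_of_nonneg_left h2 (add_pos (hp 0) (hp 1)).le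
  rw [mul_assoc, ← div_eq_inv_mul, le_div_iff₀' (hp i)]
  have m0 := mul_nonneg (hp 0).le (hn 0)
  have m1 := mul_nonneg (hp 1).le (hn 1)
  rcases Fin.exists_fin_two.1 ⟨i, rfl⟩ with rfl | rfl <;> nlinarith

theorem integral_norm_mul_trans (ht : t ≤ M.T) (n : ℕ × ℕ) :
    ∫ s in Ioc u t, ‖pay n.1 n.2 * M.trans k n s‖ ∂timeMeasure
      = ‖pay n.1 n.2‖ * ∫ s in Ioc u t, M.trans k n s ∂timeMeasure := by
  rw [← integral_const_mul]
  refine setIntegral_congr_fun measurableSet_Ioc fun s hs => ?_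
  rw [norm_mul, Real.norm_of_nonneg (M.trans_nonneg k n (NNReal.coe_le_coe.2 (hs.2.trans ht)))]

theorem summable_integral_of_le {C : ℝ} (h : M.HasValue pay u k) (hut : u ≤ t) (ht : t ≤ M.T)
    {l : Fin 2 → ℕ}
    (hl : ∀ n, ∫ s in Ioc u t, M.trans l n s ∂timeMeasure ≤ C * M.trans k n u) :
    Summable fun n : ℕ × ℕ => ∫ s in Ioc u t, ‖pay n.1 n.2 * M.trans l n s‖ ∂timeMeasure := by
  refine Summable.of_nonneg_of_le (fun n => integral_nonneg fun s => norm_nonneg _) (fun n => ?_)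
    (h.norm.mul_left C)
  rw [integral_norm_mul_trans ht, norm_mul,
    Real.norm_of_nonneg (M.trans_nonneg k n (NNReal.coe_le_coe.2 (hut.trans ht))), mul_left_comm]
  exact mul_le_mul_of_nonneg_left (hl n) (norm_nonneg _)

theorem HasValue.summable_integral (h : M.HasValue pay u k) (hut : u ≤ t) (ht : t ≤ M.T) :
    Summable fun n : ℕ × ℕ => ∫ s in Ioc u t, ‖pay n.1 n.2 * M.trans k n s‖ ∂timeMeasure :=
  summable_integral_of_le h hut ht fun n => integral_trans_le k n hut ht

theorem HasValue.summable_integral_add_single (h : M.HasValue pay u k) (hut : u ≤ t)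
    (ht : t ≤ M.T) (i : Fin 2) : Summable fun n : ℕ × ℕ =>
      ∫ s in Ioc u t, ‖pay n.1 n.2 * M.trans (k + Pi.single i 1) n s‖ ∂timeMeasure :=
  summable_integral_of_le h hut ht fun n => integral_trans_add_single_le k n hut ht i

/-- The time integrals over `(u, t]` are summable, so the series converges at almost every time
there. As the interval has positive length there is such a time, and convergence persists from it up
to `t`. -/
theorem HasValue.add_single (h : M.HasValue pay u k) (hut : u < t) (ht : t ≤ M.T) (i : Fin 2) :
    M.HasValue pay t (k + Pi.single i 1) := by
  have hae := ae_summable_norm_of_summable_integral (fun n => integrableOn_mul_trans n)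
    (h.summable_integral_add_single hut.le ht i)
  rw [ae_restrict_iff' measurableSet_Ioc] at hae
  have hpos : timeMeasure (Ioc u t) ≠ 0 := by
    rw [timeMeasure_Ioc]
    simpa using hut
  obtain ⟨s, hs, hsum⟩ := (frequently_ae_mem_iff.2 hpos).and_eventually hae |>.exists
  exact HasValue.mono (u := s) (hsum hs).of_norm hs.2 ht

/-- Induction on the total number of goals. Each goal uses up a little time, which is why `t` must
be positive; at time `0` only the score `0` is covered. -/
theorem HasValue.of_zero (h : M.HasValue pay 0 0) (ht0 : 0 < t) (ht : t ≤ M.T)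
    (k : Fin 2 → ℕ) : M.HasValue pay t k := by
  have key : ∀ (m : ℕ) (k : Fin 2 → ℕ), k 0 + k 1 = m → ∀ t, 0 < t → t ≤ M.T →
      M.HasValue pay t k := by
    intro m
    induction m with
    | zero =>
      intro k hk t ht0 ht
      obtain rfl : k = 0 := by
        ext i
        fin_cases i <;> simp <;> omega
      exact h.mono zero_le ht
    | succ m ih =>
      intro k hk t ht0 ht
      obtain ⟨i, hi⟩ : ∃ i, k i ≠ 0 := by
        by_contra! hc
        rw [hc, hc] at hk
        omega
      have hle : (Pi.single i 1 : Fin 2 → ℕ) ≤ k := by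
        intro j
        by_cases hj : j = i
        · subst hj; simp; omega
        · simp [hj]
      obtain ⟨s, hs0, hst⟩ := exists_between ht0
      have hsum : (k - Pi.single i 1 : Fin 2 → ℕ) 0 + (k - Pi.single i 1 : Fin 2 → ℕ) 1 = m := by
        fin_cases i <;> simp at hi ⊢ <;> omega
      have := (ih (k - Pi.single i 1) hsum s hs0 (hst.le.trans ht)).add_single hst ht i
      rwa [tsub_add_cancel_of_le hle] at this
  exact key _ k rfl t ht0 ht

theorem HasValue.integrableOn (h : M.HasValue pay u k) (hut : u ≤ t) (ht : t ≤ M.T) :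
    IntegrableOn (fun s => M.scoreValue pay s k) (Ioc u t) timeMeasure :=
  integrable_tsum_of_summable_integral (fun n => integrableOn_mul_trans n)
    (h.summable_integral hut ht)

theorem HasValue.integrableOn_add_single (h : M.HasValue pay u k) (hut : u ≤ t) (ht : t ≤ M.T)
    (i : Fin 2) :
    IntegrableOn (fun s => M.scoreValue pay s (k + Pi.single i 1)) (Ioc u t) timeMeasure :=
  integrable_tsum_of_summable_integral (fun n => integrableOn_mul_trans n)
    (h.summable_integral_add_single hut ht i)

theorem HasValue.integrableOn_forwardDiff (h : M.HasValue pay u k) (hut : u ≤ t) (ht : t ≤ M.T)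
    (i : Fin 2) :
    IntegrableOn (fun s => forwardDiff i (M.scoreValue pay s) k) (Ioc u t) timeMeasure :=
  (h.integrableOn_add_single hut ht i).sub (h.integrableOn hut ht)

/-- The backward Kolmogorov equation in integrated form. -/
theorem HasValue.scoreValue_sub (h : M.HasValue pay u k) (hut : u ≤ t) (ht : t ≤ M.T) :
    M.scoreValue pay t k - M.scoreValue pay u k =
      - (M.lam 0 * ∫ s in Ioc u t, forwardDiff 0 (M.scoreValue pay s) k ∂timeMeasure)
      - M.lam 1 * ∫ s in Ioc u t, forwardDiff 1 (M.scoreValue pay s) k ∂timeMeasure := by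
  have hk := hasSum_integral_of_summable_integral_norm (fun n => integrableOn_mul_trans n)
    (h.summable_integral hut ht)
  have hi := fun i => hasSum_integral_of_summable_integral_norm
    (fun n => integrableOn_mul_trans n) (h.summable_integral_add_single hut ht i)
  have h1 := (h.mono hut ht).hasSum.sub h.hasSum
  have h2 := ((((hi 0).sub hk).mul_left (M.lam 0 : ℝ)).neg).sub
    (((hi 1).sub hk).mul_left (M.lam 1 : ℝ))
  have e : ∀ i : Fin 2, ∫ s in Ioc u t, forwardDiff i (M.scoreValue pay s) k ∂timeMeasure =
      (∫ s in Ioc u t, M.scoreValue pay s (k + Pi.single i 1) ∂timeMeasure)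
        - ∫ s in Ioc u t, M.scoreValue pay s k ∂timeMeasure := fun i =>
    integral_sub (h.integrableOn_add_single hut ht i) (h.integrableOn hut ht)
  rw [e, e]
  unfold scoreValue
  -- Both sides are now sums over the final scores, compared term by term through the equation for
  -- `trans`.
  refine h1.unique ?_
  convert h2 using 2 with n
  have h3 := integral_generator_trans (M := M) k n hut
  rw [integral_generator_trans_eq] at h3
  simp only [integral_const_mul]
  linear_combination (pay n.1 n.2) * h3

/-- Weierstrass test, with the terms at time `u` as majorants. -/
theorem HasValue.continuousOn (h : M.HasValue pay u k) :
    ContinuousOn (fun s => M.scoreValue pay s k) (Icc u M.T) := by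
  refine continuousOn_tsum (u := fun n : ℕ × ℕ =>
    Real.exp ((M.lam 0 + M.lam 1) * (M.T - u)) * ‖pay n.1 n.2 * M.trans k n u‖)
    (fun n => ?_) (h.norm.mul_left _) fun n s hs => ?_
  · have := M.continuous_trans k n
    fun_prop
  · refine (norm_mul_trans_le hs.1 hs.2 n).trans ?_
    refine mul_le_mul_of_nonneg_right (Real.exp_le_exp.2 ?_) (norm_nonneg _)
    refine mul_le_mul_of_nonneg_left ?_ (add_nonneg (M.lam 0).2 (M.lam 1).2)
    have : (s : ℝ) ≤ M.T := hs.2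
    linarith

theorem scoreValue_T (k : Fin 2 → ℕ) : M.scoreValue pay M.T k = pay (k 0) (k 1) := by
  unfold scoreValue
  rw [tsum_eq_single (k 0, k 1)]
  · simp [trans_T]
  · intro n hn
    simp [trans_T, hn]

/-- Reindex by `n = k + j`. Absolute convergence is what allows the iterated sum to replace the sum
over pairs. -/
theorem HasValue.europeanValue_eq (h : M.HasValue pay t k) :
    M.europeanValue pay t k = M.scoreValue pay t k := by
  have hinj : Function.Injective fun j : ℕ × ℕ => (k 0 + j.1, k 1 + j.2) := by
    rintro ⟨a, b⟩ ⟨c, d⟩ h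
    simp only [Prod.mk.injEq] at h
    ext <;> simp <;> omega
  have hsupp : Function.support (fun n : ℕ × ℕ => pay n.1 n.2 * M.trans k n t) ⊆
      range fun j : ℕ × ℕ => (k 0 + j.1, k 1 + j.2) := by
    intro n hn
    by_cases h0 : k 0 ≤ n.1
    · by_cases h1 : k 1 ≤ n.2
      · exact ⟨(n.1 - k 0, n.2 - k 1), by ext <;> simp <;> omega⟩
      · simp [trans, poissonShift, h1] at hn
    · simp [trans, poissonShift, h0] at hn
  have hs : Summable fun j : ℕ × ℕ => pay (k 0 + j.1) (k 1 + j.2)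
      * M.trans k (k 0 + j.1, k 1 + j.2) t := h.comp_injective hinj
  unfold scoreValue
  rw [← hinj.tsum_eq hsupp, hs.tsum_prod]
  simp [europeanValue, trans, poissonShift, mul_assoc]

end BettingMarket

/-! ### Step paths, Stieltjes integrals and the pathwise change of variables. -/

namespace BettingMarket

variable {Ω : Type*} [MeasurableSpace Ω] {P : Measure Ω} (M : BettingMarket P)
  {pay : ℕ → ℕ → ℝ} {u t : ℝ≥0} {ω : Ω}

theorem score_mono (ω : Ω) : Monotone fun t => M.score t ω :=
  fun _ _ h i => (M.poisson i).mono ω h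

theorem score_zero (ω : Ω) : M.score 0 ω = 0 := by
  ext i
  exact (M.poisson i).zero ω

theorem exists_score_eq_right (t : ℝ≥0) (ω : Ω) :
    ∃ v > t, ∀ s ∈ Ico t v, M.score s ω = M.score t ω := by
  have h : ∀ᶠ s in 𝓝[≥] t, ∀ i, M.N i s ω = M.N i t ω := by
    rw [eventually_all]
    intro i
    have := (M.poisson i).right_continuous ω t
    rw [ContinuousWithinAt, nhds_discrete, tendsto_pure] at this
    exact this
  obtain ⟨v, hv, hs⟩ := mem_nhdsGE_iff_exists_Ico_subset.1 h
  exact ⟨v, hv, fun s hs' => funext fun i => hs hs' i⟩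

theorem exists_score_eq_left (ht : 0 < t) (ω : Ω) :
    ∃ u < t, ∀ s ∈ Ico u t, M.score s ω = M.score u ω := by
  have hbdd : ∀ m ∈ (fun s => M.N 0 s ω + M.N 1 s ω) '' Iio t, m ≤ M.N 0 t ω + M.N 1 t ω := by
    rintro _ ⟨s, hs, rfl⟩
    exact add_le_add ((M.poisson 0).mono ω (le_of_lt hs)) ((M.poisson 1).mono ω (le_of_lt hs))
  -- The total score before `t` is a bounded set of naturals, so its maximum is attained at some `u
  -- < t`. By monotonicity neither component can change on `[u, t)`.
  obtain ⟨u, hu, hmax⟩ := Nat.sSup_mem (s := (fun s => M.N 0 s ω + M.N 1 s ω) '' Iio t)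
    ⟨_, mem_image_of_mem _ ht⟩ ⟨_, hbdd⟩
  refine ⟨u, hu, fun s hs => ?_⟩
  have h1 : M.N 0 s ω + M.N 1 s ω ≤ M.N 0 u ω + M.N 1 u ω := by
    have := le_csSup ⟨_, hbdd⟩ (mem_image_of_mem (fun s => M.N 0 s ω + M.N 1 s ω) hs.2)
    rwa [← hmax] at this
  have h2 := M.score_mono ω hs.1
  have h20 : M.N 0 u ω ≤ M.N 0 s ω := h2 0
  have h21 : M.N 1 u ω ≤ M.N 1 s ω := h2 1
  ext i
  rcases Fin.exists_fin_two.1 ⟨i, rfl⟩ with rfl | rfl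
  · change M.N 0 s ω = M.N 0 u ω
    omega
  · change M.N 1 s ω = M.N 1 u ω
    omega

/-- A relation between times that is reflexive, transitive and holds between `u < t` as soon as
no team scores in `(u, t)`, holds between `0` and all times. -/
theorem path_induction {Pr : ℝ≥0 → ℝ≥0 → Prop} (refl : ∀ t, Pr t t)
    (trans : ∀ u v t, u ≤ v → v ≤ t → Pr u v → Pr v t → Pr u t)
    (step : ∀ u t, u < t → (∀ s ∈ Ico u t, M.score s ω = M.score u ω) → Pr u t) (t : ℝ≥0) :
    Pr 0 t := by
  induction hm : M.N 0 t ω + M.N 1 t ω using Nat.strong_induction_on generalizing t with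
  | _ m ih =>
  set S : Set ℝ≥0 := {s | M.score s ω = M.score t ω} with hS
  have htS : t ∈ S := rfl
  -- `c` is the first time with the score of `t`, attained by right-continuity. No goal falls in
  -- `(c, t]`, and just before `c` the total is smaller, which feeds the induction.
  set c := sInf S with hc
  have hct : c ≤ t := csInf_le (OrderBot.bddBelow _) htS
  have hcS : c ∈ S := by
    obtain ⟨v, hv, hvs⟩ := M.exists_score_eq_right c ω
    obtain ⟨s, hs, hsv⟩ := exists_lt_of_csInf_lt ⟨t, htS⟩ hv
    exact (hvs s ⟨csInf_le (OrderBot.bddBelow _) hs, hsv⟩).symm.trans hs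
  have hconst : ∀ s ∈ Ico c t, M.score s ω = M.score c ω := by
    intro s hs
    refine le_antisymm ?_ (M.score_mono ω hs.1)
    rw [hcS]
    exact M.score_mono ω hs.2.le
  have hPct : Pr c t := by
    rcases hct.eq_or_lt with h | h
    · rw [h]; exact refl t
    · exact step c t h hconst
  rcases eq_or_ne c 0 with h0 | h0
  · rwa [h0] at hPct
  obtain ⟨u, huc, hu⟩ := M.exists_score_eq_left (pos_iff_ne_zero.2 h0) ω
  have hne : M.score u ω ≠ M.score c ω := fun h =>
    (csInf_le (OrderBot.bddBelow _) (show u ∈ S from h.trans hcS)).not_gt huc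
  have hlt : M.N 0 u ω + M.N 1 u ω < m := by
    have h2 := M.score_mono ω huc.le
    have h20 : M.N 0 u ω ≤ M.N 0 c ω := h2 0
    have h21 : M.N 1 u ω ≤ M.N 1 c ω := h2 1
    have e0 : M.N 0 c ω = M.N 0 t ω := congrFun hcS 0
    have e1 : M.N 1 c ω = M.N 1 t ω := congrFun hcS 1
    by_contra! hge
    refine hne (funext fun i => ?_)
    rcases Fin.exists_fin_two.1 ⟨i, rfl⟩ with rfl | rfl
    · change M.N 0 u ω = M.N 0 c ω
      omega
    · change M.N 1 u ω = M.N 1 c ω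
      omega
  exact trans 0 c t zero_le hct (trans 0 u c zero_le huc.le (ih _ hlt u rfl) (step u c huc hu))
    hPct

variable {M}

theorem scoreBefore_eq (hc : ∀ s ∈ Ico u t, M.score s ω = M.score u ω) {s : ℝ≥0}
    (hs : s ∈ Ioc u t) : M.scoreBefore s ω = M.score u ω := by
  have hne : (𝓝[<] s).NeBot := nhdsLT_neBot_of_exists_lt ⟨u, hs.1⟩
  ext i
  refine leftLim_eq_of_tendsto (tendsto_const_nhds.congr' ?_)
  filter_upwards [Ioo_mem_nhdsLT hs.1] with r hr
  exact (congrFun (hc r ⟨hr.1.le, hr.2.trans_le hs.2⟩) i).symm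

/-- With no goal inside `(u, t)`, all the mass of `dN` on `(u, t]` sits at `t`. -/
theorem restrict_path_measure (hut : u < t) (hc : ∀ s ∈ Ico u t, M.score s ω = M.score u ω)
    (i : Fin 2) :
    (M.path i ω).measure.restrict (Ioc u t) =
      ENNReal.ofReal ((M.N i t ω : ℝ) - M.N i u ω) • Measure.dirac t := by
  have hne : (𝓝[<] t).NeBot := nhdsLT_neBot_of_exists_lt ⟨u, hut⟩
  have hl : Function.leftLim (M.path i ω) t = M.N i u ω := by
    refine leftLim_eq_of_tendsto (tendsto_const_nhds.congr' ?_)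
    filter_upwards [Ioo_mem_nhdsLT hut] with r hr
    exact congrArg Nat.cast (congrFun (hc r ⟨hr.1.le, hr.2⟩) i).symm
  have h0 : (M.path i ω).measure (Ioo u t) = 0 := by
    rw [StieltjesFunction.measure_Ioo, hl]
    simp [path]
  rw [← Ioo_insert_right hut, insert_eq, Measure.restrict_union (by simp) measurableSet_Ioo,
    Measure.restrict_eq_zero.2 h0, add_zero, Measure.restrict_singleton,
    StieltjesFunction.measure_singleton, hl]
  rfl

theorem integrableOn_path_of_const (hut : u < t)
    (hc : ∀ s ∈ Ico u t, M.score s ω = M.score u ω) (i : Fin 2) (f : ℝ≥0 → ℝ) :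
    IntegrableOn f (Ioc u t) (M.path i ω).measure := by
  rw [IntegrableOn, restrict_path_measure hut hc]
  exact (integrable_dirac (by simp)).smul_measure ENNReal.ofReal_ne_top

theorem integral_path_of_const (hut : u < t) (hc : ∀ s ∈ Ico u t, M.score s ω = M.score u ω)
    (i : Fin 2) (f : ℝ≥0 → ℝ) :
    ∫ s in Ioc u t, f s ∂(M.path i ω).measure = ((M.N i t ω : ℝ) - M.N i u ω) * f t := by
  rw [restrict_path_measure hut hc, integral_smul_measure, integral_dirac,
    ENNReal.toReal_ofReal, smul_eq_mul]
  exact sub_nonneg.2 (Nat.cast_le.2 ((M.poisson i).mono ω hut.le))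

-- On a bounded interval `dN` is a finite sum of point masses, so even nonmeasurable integrands are
-- integrable.
variable (M) in
theorem integrableOn_path (i : Fin 2) (f : ℝ≥0 → ℝ) (t : ℝ≥0) (ω : Ω) :
    IntegrableOn f (Ioc 0 t) (M.path i ω).measure := by
  refine M.path_induction (ω := ω)
    (Pr := fun u t => IntegrableOn f (Ioc u t) (M.path i ω).measure) (by simp) ?_ ?_ t
  · intro u v t huv hvt h1 h2
    rw [← Ioc_union_Ioc_eq_Ioc huv hvt]
    exact h1.union h2
  · exact fun u t hut hc => integrableOn_path_of_const hut hc i f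

variable (M) in
theorem ae_path_isGoalTime (i : Fin 2) (t : ℝ≥0) (ω : Ω) :
    ∀ᵐ s ∂(M.path i ω).measure.restrict (Ioc 0 t), M.IsGoalTime i s ω := by
  refine M.path_induction (ω := ω)
    (Pr := fun u t => ∀ᵐ s ∂(M.path i ω).measure.restrict (Ioc u t), M.IsGoalTime i s ω)
    (by simp) ?_ ?_ t
  · intro u v t huv hvt h1 h2
    rw [← Ioc_union_Ioc_eq_Ioc huv hvt, ae_restrict_union_iff]
    exact ⟨h1, h2⟩
  · intro u t hut hc
    rw [restrict_path_measure hut hc]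
    by_cases h : M.N i t ω = M.N i u ω
    · simp [h]
    · refine Measure.ae_smul_measure ?_ _
      rw [ae_dirac_eq]
      change M.score t ω i ≠ M.scoreBefore t ω i
      rw [scoreBefore_eq hc ⟨hut, le_rfl⟩]
      exact h

variable (M) in
/-- On the path `ω`, goals are scored one at a time until the end of the game. -/
def IsSimple (ω : Ω) : Prop :=
  ∀ t, 0 < t → t ≤ M.T → M.score t ω = M.scoreBefore t ω ∨
    ∃ i, M.score t ω = M.scoreBefore t ω + Pi.single i 1

theorem HasValue.of_score (h : M.HasValue pay 0 0) (ht : t ≤ M.T) (ω : Ω) :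
    M.HasValue pay t (M.score t ω) := by
  rcases eq_or_ne t 0 with rfl | h0
  · rwa [score_zero]
  · exact h.of_zero (pos_iff_ne_zero.2 h0) ht _

theorem integrableOn_scoreBefore {f : ℝ≥0 → (Fin 2 → ℕ) → ℝ}
    (hf : ∀ u t, u ≤ t → t ≤ M.T → IntegrableOn (fun s => f s (M.score u ω)) (Ioc u t) timeMeasure)
    (ht : t ≤ M.T) : IntegrableOn (fun s => f s (M.scoreBefore s ω)) (Ioc 0 t) timeMeasure := by
  refine M.path_induction (ω := ω)
    (Pr := fun u t => t ≤ M.T →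
      IntegrableOn (fun s => f s (M.scoreBefore s ω)) (Ioc u t) timeMeasure)
    (by simp) ?_ ?_ t ht
  · intro u v t huv hvt h1 h2 ht
    rw [← Ioc_union_Ioc_eq_Ioc huv hvt]
    exact (h1 (hvt.trans ht)).union (h2 ht)
  · intro u t hut hc ht
    refine (hf u t hut.le ht).congr_fun (fun s hs => ?_) measurableSet_Ioc
    simp only [scoreBefore_eq hc hs]

theorem HasValue.integrableOn_hedge (h : M.HasValue pay 0 0) (i : Fin 2) (ht : t ≤ M.T) (ω : Ω) :
    IntegrableOn (fun s => forwardDiff i (M.scoreValue pay s) (M.scoreBefore s ω)) (Ioc 0 t)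
      timeMeasure :=
  integrableOn_scoreBefore (f := fun s => forwardDiff i (M.scoreValue pay s))
    (fun _ _ hut ht => (h.of_score (hut.trans ht) ω).integrableOn_forwardDiff hut ht i) ht

/-- Change of variables along a path. -/
theorem HasValue.scoreValue_eq (h : M.HasValue pay 0 0) (hω : M.IsSimple ω) (ht : t ≤ M.T) :
    M.scoreValue pay t (M.score t ω) = M.scoreValue pay 0 0
      + M.stockIntegral 0 (fun s => forwardDiff 0 (M.scoreValue pay s) (M.scoreBefore s ω)) t ω
      + M.stockIntegral 1 (fun s => forwardDiff 1 (M.scoreValue pay s) (M.scoreBefore s ω)) t ω :=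
    by
  set H : Fin 2 → ℝ≥0 → ℝ := fun i s => forwardDiff i (M.scoreValue pay s) (M.scoreBefore s ω)
    with hH
  have key := M.path_induction (ω := ω) (Pr := fun u t => t ≤ M.T →
      M.scoreValue pay t (M.score t ω) - M.scoreValue pay u (M.score u ω) =
        ((∫ s in Ioc u t, H 0 s ∂(M.path 0 ω).measure)
          - M.lam 0 * ∫ s in Ioc u t, H 0 s ∂timeMeasure)
        + ((∫ s in Ioc u t, H 1 s ∂(M.path 1 ω).measure)
          - M.lam 1 * ∫ s in Ioc u t, H 1 s ∂timeMeasure)) (by simp) ?_ ?_ t ht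
  · rw [score_zero] at key
    simp only [stockIntegral]
    linarith
  · intro u v t huv hvt h1 h2 ht
    have e1 := fun i => setIntegral_union (μ := (M.path i ω).measure) (f := H i)
      (Ioc_disjoint_Ioc_of_le (a := u) (d := t) (le_refl v)) measurableSet_Ioc
      ((M.integrableOn_path i (H i) v ω).mono_set (Ioc_subset_Ioc_left zero_le))
      ((M.integrableOn_path i (H i) t ω).mono_set (Ioc_subset_Ioc_left zero_le))
    have e2 := fun i => setIntegral_union (μ := timeMeasure) (f := H i)
      (Ioc_disjoint_Ioc_of_le (a := u) (d := t) (le_refl v)) measurableSet_Ioc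
      ((h.integrableOn_hedge i (hvt.trans ht) ω).mono_set (Ioc_subset_Ioc_left zero_le))
      ((h.integrableOn_hedge i ht ω).mono_set (Ioc_subset_Ioc_left zero_le))
    simp only [Ioc_union_Ioc_eq_Ioc huv hvt] at e1 e2
    rw [e1, e1, e2, e2]
    linarith [h1 (hvt.trans ht), h2 ht]
  · intro u t hut hc ht
    have e : ∀ i, ∫ s in Ioc u t, H i s ∂timeMeasure =
        ∫ s in Ioc u t, forwardDiff i (M.scoreValue pay s) (M.score u ω) ∂timeMeasure := fun i =>
      setIntegral_congr_fun measurableSet_Ioc fun s hs => by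
        simp only [hH, scoreBefore_eq hc hs]
    have hb := scoreBefore_eq hc (s := t) ⟨hut, le_rfl⟩
    have hsub := (h.of_score (hut.le.trans ht) ω).scoreValue_sub hut.le ht
    rw [e, e, integral_path_of_const hut hc, integral_path_of_const hut hc]
    have hN : ∀ i, M.N i t ω = M.score t ω i := fun i => rfl
    have hN' : ∀ i, M.N i u ω = M.score u ω i := fun i => rfl
    have hHt : ∀ i, H i t = forwardDiff i (M.scoreValue pay t) (M.score u ω) := fun i => by
      simp only [hH, hb]
    simp only [hN, hN', hHt]
    -- The drift at the fixed score is `hsub`. A single goal at `t` adds one forward difference,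
    -- which is the whole `dN`-integral; two simultaneous goals would break this identity.
    rcases hω t (hut.pos) ht with h1 | ⟨i, h1⟩
    · rw [h1, hb]
      simp only [sub_self]
      linarith
    · rw [h1, hb]
      rcases Fin.exists_fin_two.1 ⟨i, rfl⟩ with rfl | rfl <;>
      · simp [forwardDiff] at hsub ⊢
        linarith

end BettingMarket

/-! ### Goals almost surely come one at a time. -/

theorem poissonMeasure_real_one_le (r : ℝ≥0) : (poissonMeasure r).real {n | 1 ≤ n} ≤ r := by
  have h : ({n | 1 ≤ n} : Set ℕ) = {0}ᶜ := by ext n; simp; omega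
  rw [h, measureReal_compl (measurableSet_singleton _), poissonMeasure_real_singleton]
  have := Real.one_sub_le_exp_neg (r : ℝ)
  simp
  linarith

/-- `1 - exp (-r) (1 + r) ≤ 1 - (1 - r) (1 + r) = r ^ 2`. -/
theorem poissonMeasure_real_two_le (r : ℝ≥0) :
    (poissonMeasure r).real {n | 2 ≤ n} ≤ (r : ℝ) ^ 2 := by
  have h : ({n | 2 ≤ n} : Set ℕ) = ({0} ∪ {1})ᶜ := by ext n; simp; omega
  rw [h, measureReal_compl (by measurability),
    measureReal_union (by simp) (measurableSet_singleton _), poissonMeasure_real_singleton,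
    poissonMeasure_real_singleton]
  have h1 := Real.one_sub_le_exp_neg (r : ℝ)
  have h2 := mul_le_mul_of_nonneg_right h1 (add_nonneg zero_le_one r.2)
  simp at h2 ⊢
  nlinarith

namespace BettingMarket

variable {Ω : Type*} [MeasurableSpace Ω] {P : Measure Ω} {M : BettingMarket P}
  {pay : ℕ → ℕ → ℝ} {u t : ℝ≥0} {ω : Ω}

theorem score_le_scoreBefore (h : u < t) (ω : Ω) : M.score u ω ≤ M.scoreBefore t ω := by
  obtain ⟨v, hv, hc⟩ := M.exists_score_eq_left h.pos ω
  rw [scoreBefore_eq hc ⟨hv, le_rfl⟩, ← hc (max u v) ⟨le_max_right _ _, max_lt h hv⟩]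
  exact M.score_mono ω (le_max_left _ _)

theorem scoreBefore_zero (ω : Ω) : M.scoreBefore 0 ω = 0 := by
  ext i
  exact (leftLim_eq_of_isBot isBot_bot).trans ((M.poisson i).zero ω)

theorem scoreBefore_le_score (t : ℝ≥0) (ω : Ω) : M.scoreBefore t ω ≤ M.score t ω := by
  rcases eq_or_ne t 0 with rfl | h
  · rw [scoreBefore_zero]
    exact fun _ => Nat.zero_le _
  obtain ⟨v, hv, hc⟩ := M.exists_score_eq_left (pos_iff_ne_zero.2 h) ω
  rw [scoreBefore_eq hc ⟨hv, le_rfl⟩]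
  exact M.score_mono ω hv.le

theorem two_le_increment_of_not_isSimple (hω : ¬ M.IsSimple ω) :
    ∃ t, 0 < t ∧ t ≤ M.T ∧ ∀ u v, u < t → t ≤ v →
      2 ≤ (M.N 0 v ω - M.N 0 u ω) + (M.N 1 v ω - M.N 1 u ω) := by
  unfold IsSimple at hω
  push Not at hω
  obtain ⟨t, ht0, htT, hne, hs⟩ := hω
  refine ⟨t, ht0, htT, fun u v hu hv => ?_⟩
  have h1 := score_le_scoreBefore (M := M) hu ω
  have h2 := scoreBefore_le_score (M := M) t ω
  have h3 := M.score_mono ω hv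
  have a0 : M.N 0 u ω ≤ M.scoreBefore t ω 0 := h1 0
  have a1 : M.N 1 u ω ≤ M.scoreBefore t ω 1 := h1 1
  have b0 : M.scoreBefore t ω 0 ≤ M.score t ω 0 := h2 0
  have b1 : M.scoreBefore t ω 1 ≤ M.score t ω 1 := h2 1
  have c0 : M.score t ω 0 ≤ M.N 0 v ω := h3 0
  have c1 : M.score t ω 1 ≤ M.N 1 v ω := h3 1
  by_contra! hlt
  have hcase : (M.score t ω 0 = M.scoreBefore t ω 0 ∧ M.score t ω 1 = M.scoreBefore t ω 1) ∨
      (M.score t ω 0 = M.scoreBefore t ω 0 + 1 ∧ M.score t ω 1 = M.scoreBefore t ω 1) ∨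
      (M.score t ω 0 = M.scoreBefore t ω 0 ∧ M.score t ω 1 = M.scoreBefore t ω 1 + 1) := by
    omega
  rcases hcase with ⟨e0, e1⟩ | ⟨e0, e1⟩ | ⟨e0, e1⟩
  · refine hne (funext fun i => ?_)
    rcases Fin.exists_fin_two.1 ⟨i, rfl⟩ with rfl | rfl <;> assumption
  · refine hs 0 (funext fun i => ?_)
    rcases Fin.exists_fin_two.1 ⟨i, rfl⟩ with rfl | rfl <;> simpa
  · refine hs 1 (funext fun i => ?_)
    rcases Fin.exists_fin_two.1 ⟨i, rfl⟩ with rfl | rfl <;> simpa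

/-- Two goals come from one team or one from each. With `a`, `b` the two Poisson parameters,
independence of the teams bounds the probability by `a² + b² + ab ≤ (a + b)²`. -/
theorem measure_two_le_increment [IsProbabilityMeasure P] (hut : u ≤ t) :
    P.real {ω | 2 ≤ (M.N 0 t ω - M.N 0 u ω) + (M.N 1 t ω - M.N 1 u ω)} ≤
      ((M.μ 0 + M.μ 1) * (t - u)) ^ 2 := by
  set D : Fin 2 → Ω → ℕ := fun i ω => M.N i t ω - M.N i u ω with hD
  have hlaw := fun i => (M.poisson i).law_increment u t hut
  have hm : ∀ i (n : ℕ), P.real {ω | n ≤ D i ω} =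
      (poissonMeasure (M.μ i * (t - u))).real {m | n ≤ m} := fun i n => by
    rw [Measure.real, Measure.real, ← (hlaw i).measure_eq (p := fun m => n ≤ m)
      (MeasurableSet.of_discrete)]
  have hr : ∀ i, ((M.μ i * (t - u) : ℝ≥0) : ℝ) = M.μ i * (t - u) := fun i => by
    rw [NNReal.coe_mul, NNReal.coe_sub hut]
  have h1 : ∀ i, P.real {ω | 1 ≤ D i ω} ≤ M.μ i * (t - u) := fun i => by
    rw [hm, ← hr]
    exact poissonMeasure_real_one_le _
  have h2 : ∀ i, P.real {ω | 2 ≤ D i ω} ≤ (M.μ i * (t - u)) ^ 2 := fun i => by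
    rw [hm, ← hr]
    exact poissonMeasure_real_two_le _
  have hind : IndepFun (D 0) (D 1) P :=
    M.indep.comp (φ := fun f : ℝ≥0 → ℕ => f t - f u) (ψ := fun f : ℝ≥0 → ℕ => f t - f u)
      (by fun_prop) (by fun_prop)
  have h12 : P.real ({ω | 1 ≤ D 0 ω} ∩ {ω | 1 ≤ D 1 ω}) ≤
      (M.μ 0 * (t - u)) * (M.μ 1 * (t - u)) := by
    have := hind.measure_inter_preimage_eq_mul {n | 1 ≤ n} {n | 1 ≤ n} (MeasurableSet.of_discrete)
      (MeasurableSet.of_discrete)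
    have e : P.real ({ω | 1 ≤ D 0 ω} ∩ {ω | 1 ≤ D 1 ω}) =
        P.real {ω | 1 ≤ D 0 ω} * P.real {ω | 1 ≤ D 1 ω} := by
      rw [Measure.real, Measure.real, Measure.real, ← ENNReal.toReal_mul]
      exact congrArg _ this
    rw [e]
    exact mul_le_mul (h1 0) (h1 1) measureReal_nonneg (measureReal_nonneg.trans (h1 0))
  have hsub : {ω | 2 ≤ D 0 ω + D 1 ω} ⊆
      ({ω | 2 ≤ D 0 ω} ∪ {ω | 2 ≤ D 1 ω}) ∪ ({ω | 1 ≤ D 0 ω} ∩ {ω | 1 ≤ D 1 ω}) := by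
    intro ω h
    simp only [mem_ofPred_eq, mem_union, mem_inter_iff] at h ⊢
    omega
  have h3 := (measureReal_mono (μ := P) hsub).trans (measureReal_union_le _ _)
  have h4 := measureReal_union_le (μ := P) {ω | 2 ≤ D 0 ω} {ω | 2 ≤ D 1 ω}
  have h5 : 0 ≤ (M.μ 0 * (t - u) : ℝ) * (M.μ 1 * (t - u)) := measureReal_nonneg.trans h12
  calc P.real {ω | 2 ≤ D 0 ω + D 1 ω} ≤ _ := h3
    _ ≤ (M.μ 0 * (t - u) : ℝ) ^ 2 + (M.μ 1 * (t - u)) ^ 2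
        + (M.μ 0 * (t - u)) * (M.μ 1 * (t - u)) := by
      linarith [h2 0, h2 1]
    _ ≤ _ := by nlinarith

variable (M) in
theorem ae_isSimple [IsProbabilityMeasure P] : ∀ᵐ ω ∂P, M.IsSimple ω := by
  set C : ℝ := ((M.μ 0 + M.μ 1) * M.T) ^ 2 with hC
  have hbound : ∀ n : ℕ, P {ω | ¬ M.IsSimple ω} ≤ ENNReal.ofReal (C / (n + 1 : ℕ)) := by
    intro n
    -- A grid of `n + 1` equal intervals: each contains two goals with probability at most `C / (n +
    -- 1) ^ 2`, so the total bound `C / (n + 1)` tends to `0`.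
    set g : ℕ → ℝ≥0 := fun k => k * (M.T / (n + 1 : ℕ)) with hg
    set A : ℕ → Set Ω := fun k => {ω | 2 ≤ (M.N 0 (g (k + 1)) ω - M.N 0 (g k) ω)
      + (M.N 1 (g (k + 1)) ω - M.N 1 (g k) ω)} with hA
    have hsub : {ω | ¬ M.IsSimple ω} ⊆ ⋃ k ∈ Finset.range (n + 1), A k := by
      intro ω hω
      obtain ⟨t, ht0, htT, h⟩ := two_le_increment_of_not_isSimple hω
      have hex : ∃ k, t ≤ g k := ⟨n + 1, by
        rw [hg]
        simpa [mul_div_cancel₀ M.T (Nat.cast_add_one_ne_zero (R := ℝ≥0) n)] using htT⟩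
      classical
      -- The first grid point at or after `t` is not `g 0 = 0`, so its predecessor lies strictly
      -- before `t`.
      have hk0 : Nat.find hex ≠ 0 := by
        intro h0
        have := Nat.find_spec hex
        rw [h0] at this
        simp [hg] at this
        exact ht0.ne' this
      obtain ⟨k, hk⟩ := Nat.exists_eq_succ_of_ne_zero hk0
      have hle : Nat.find hex ≤ n + 1 := Nat.find_min' hex (by
        rw [hg]
        simpa [mul_div_cancel₀ M.T (Nat.cast_add_one_ne_zero (R := ℝ≥0) n)] using htT)
      refine mem_iUnion₂.2 ⟨k, Finset.mem_range.2 (by omega), ?_⟩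
      refine h _ _ (lt_of_not_ge (Nat.find_min hex (by omega))) ?_
      have := Nat.find_spec hex
      rwa [hk] at this
    have hAk : ∀ k, P (A k) ≤ ENNReal.ofReal (C / (n + 1 : ℕ) ^ 2) := by
      intro k
      rw [← ofReal_measureReal]
      refine ENNReal.ofReal_le_ofReal ((measure_two_le_increment (M := M) ?_).trans_eq ?_)
      · exact mul_le_mul_of_nonneg_right (Nat.cast_le.2 k.le_succ) zero_le
      · simp only [hg, hC]
        push_cast
        field_simp
        ring
    calc P {ω | ¬ M.IsSimple ω} ≤ ∑ k ∈ Finset.range (n + 1), P (A k) :=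
          (measure_mono hsub).trans (measure_biUnion_finset_le _ _)
      _ ≤ ∑ k ∈ Finset.range (n + 1), ENNReal.ofReal (C / (n + 1 : ℕ) ^ 2) :=
          Finset.sum_le_sum fun k _ => hAk k
      _ = ENNReal.ofReal (C / (n + 1 : ℕ)) := by
          rw [Finset.sum_const, Finset.card_range, ← ENNReal.ofReal_nsmul, nsmul_eq_mul]
          congr 1
          field_simp
  have hlim : Tendsto (fun n : ℕ => ENNReal.ofReal (C / (n + 1 : ℕ))) atTop (𝓝 0) := by
    have := ENNReal.tendsto_ofReal
      ((tendsto_add_atTop_iff_nat 1).2 (tendsto_const_div_atTop_nhds_zero_nat C))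
    simpa using this
  exact ae_iff.2 (le_antisymm (ge_of_tendsto' hlim hbound) zero_le)

end BettingMarket

/-! ### The predictable σ-algebra and predictability of the score before `t`. -/

theorem isPiSystem_predictable {Ω ι : Type*} {m : MeasurableSpace Ω} [LinearOrder ι] [OrderBot ι]
    (𝓕 : Filtration ι m) :
    IsPiSystem ({s : Set (ι × Ω) | ∃ A, MeasurableSet[𝓕 ⊥] A ∧ s = {⊥} ×ˢ A} ∪
      {s | ∃ i A, MeasurableSet[𝓕 i] A ∧ s = Ioi i ×ˢ A}) := by
  rintro _ (⟨A, hA, rfl⟩ | ⟨i, A, hA, rfl⟩) _ (⟨B, hB, rfl⟩ | ⟨j, B, hB, rfl⟩) hne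
  · refine Or.inl ⟨A ∩ B, hA.inter hB, ?_⟩
    rw [prod_inter_prod, inter_self]
  · obtain ⟨x, ⟨hx, -⟩, hx', -⟩ := hne
    rw [mem_singleton_iff.1 hx] at hx'
    exact absurd hx' not_lt_bot
  · obtain ⟨x, ⟨hx', -⟩, hx, -⟩ := hne
    rw [mem_singleton_iff.1 hx] at hx'
    exact absurd hx' not_lt_bot
  · refine Or.inr ⟨i ⊔ j, A ∩ B, (𝓕.mono le_sup_left _ hA).inter (𝓕.mono le_sup_right _ hB), ?_⟩
    rw [prod_inter_prod, Ioi_inter_Ioi]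

theorem predictable_le_prod {Ω : Type*} {m : MeasurableSpace Ω} (𝓕 : Filtration ℝ≥0 m) :
    𝓕.predictable ≤ (inferInstance : MeasurableSpace (ℝ≥0 × Ω)) :=
  measurableSpace_le_predictable_of_measurableSet
    (fun _ hA => (measurableSet_singleton _).prod (𝓕.le _ _ hA))
    fun _ _ hA => measurableSet_Ioi.prod (𝓕.le _ _ hA)

theorem measurable_fst_predictable {Ω : Type*} {m : MeasurableSpace Ω} (𝓕 : Filtration ℝ≥0 m) :
    Measurable[𝓕.predictable] (Prod.fst : ℝ≥0 × Ω → ℝ≥0) := by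
  let := 𝓕.predictable
  refine measurable_of_Ioi fun s => ?_
  have : (Prod.fst : ℝ≥0 × Ω → ℝ≥0) ⁻¹' Ioi s = Ioi s ×ˢ univ := by ext; simp
  rw [this]
  exact measurableSet_predictable_Ioi_prod (𝓕 := 𝓕) MeasurableSet.univ

namespace BettingMarket

variable {Ω : Type*} [MeasurableSpace Ω] {P : Measure Ω} {M : BettingMarket P}
  {Q : Measure Ω} {u t : ℝ≥0} {ω : Ω}

theorem measurable_score (t : ℝ≥0) : Measurable[M.filtration t] (M.score t) :=
  (Filtration.stronglyAdapted_natural M.stronglyMeasurable_score t).measurable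

variable (M) in
theorem measurable_scoreBefore :
    Measurable[M.filtration.predictable] fun p : ℝ≥0 × Ω => M.scoreBefore p.1 p.2 := by
  let := M.filtration.predictable
  refine measurable_pi_lambda _ fun i => measurable_of_Ioi fun n => ?_
  obtain ⟨D, hDc, hD⟩ := TopologicalSpace.exists_countable_dense ℝ≥0
  -- The left limit at `t` exceeds `n` exactly when the count exceeds `n` at some `q < t` of the
  -- dense set; each such set is a generating rectangle.
  have : (fun p : ℝ≥0 × Ω => M.scoreBefore p.1 p.2 i) ⁻¹' Ioi n =
      ⋃ q ∈ D, Ioi q ×ˢ {ω | n < M.score q ω i} := by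
    ext ⟨t, ω⟩
    simp only [mem_preimage, mem_Ioi, mem_iUnion, mem_prod, mem_ofPred_eq, exists_prop]
    constructor
    · intro h
      rcases eq_or_ne t 0 with rfl | h0
      · rw [scoreBefore_zero] at h
        exact absurd h (Nat.not_lt_zero n)
      obtain ⟨u, hu, hc⟩ := M.exists_score_eq_left (pos_iff_ne_zero.2 h0) ω
      obtain ⟨q, hq, huq, hqt⟩ := hD.exists_between hu
      refine ⟨q, hq, hqt, ?_⟩
      rwa [hc q ⟨huq.le, hqt⟩, ← scoreBefore_eq hc ⟨hu, le_rfl⟩]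
    · rintro ⟨q, -, hqt, h⟩
      exact h.trans_le (score_le_scoreBefore hqt ω i)
  rw [this]
  refine MeasurableSet.biUnion hDc fun q _ => measurableSet_predictable_Ioi_prod ?_
  exact (measurable_pi_apply i).comp (measurable_score q) measurableSet_Ioi

theorem measurable_comp_scoreBefore {g : ℝ≥0 → (Fin 2 → ℕ) → ℝ}
    (hg : ∀ k, Measurable fun t => g t k) :
    Measurable[M.filtration.predictable] fun p : ℝ≥0 × Ω => g p.1 (M.scoreBefore p.1 p.2) := by
  have h : Measurable fun q : ℝ≥0 × (Fin 2 → ℕ) => g q.1 q.2 :=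
    measurable_from_prod_countable_left hg
  let := M.filtration.predictable
  exact h.comp ((measurable_fst_predictable M.filtration).prodMk M.measurable_scoreBefore)

/-! ### The compensator of the goal counts under `Q`. -/

variable (M) in
/-- The measure `dN i` on the time interval `(0, T]` of the game. -/
noncomputable def goals (i : Fin 2) (ω : Ω) : Measure ℝ≥0 :=
  (M.path i ω).measure.restrict (Ioc 0 M.T)

theorem path_measure_Ioc (i : Fin 2) (ω : Ω) (u t : ℝ≥0) :
    (M.path i ω).measure (Ioc u t) = ENNReal.ofReal ((M.N i t ω : ℝ) - M.N i u ω) :=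
  (M.path i ω).measure_Ioc u t

instance isFiniteMeasure_goals (i : Fin 2) (ω : Ω) : IsFiniteMeasure (M.goals i ω) :=
  ⟨by rw [goals, Measure.restrict_apply_univ, path_measure_Ioc]; exact ENNReal.ofReal_lt_top⟩

variable (M) in
theorem measurable_N_cast (i : Fin 2) (t : ℝ≥0) : Measurable fun ω => (M.N i t ω : ℝ) :=
  measurable_from_top.comp ((M.poisson i).measurable t)

theorem measurable_goals (i : Fin 2) : Measurable (M.goals i) := by
  refine Measurable.measure_of_isPiSystem
    (BorelSpace.measurable_eq.trans (borel_eq_generateFrom_Iic ℝ≥0)) isPiSystem_Iic ?_ ?_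
  · rintro _ ⟨a, rfl⟩
    have h : ∀ ω, M.goals i ω (Iic a) =
        ENNReal.ofReal ((M.N i (min M.T a) ω : ℝ) - M.N i 0 ω) := fun ω => by
      rw [goals, Measure.restrict_apply measurableSet_Iic, inter_comm, Ioc_inter_Iic,
        path_measure_Ioc]
    simp_rw [h]
    exact ENNReal.measurable_ofReal.comp ((M.measurable_N_cast i _).sub (M.measurable_N_cast i _))
  · simp_rw [goals, Measure.restrict_apply_univ, path_measure_Ioc]
    exact ENNReal.measurable_ofReal.comp ((M.measurable_N_cast i _).sub (M.measurable_N_cast i _))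

/-- This kernel measurability is what makes the `bind` in `goalMeasure` an iterated integral. -/
theorem measurable_goals_map (i : Fin 2) :
    Measurable fun ω => (M.goals i ω).map fun t => (t, ω) := by
  have hm : ∀ ω : Ω, Measurable fun t : ℝ≥0 => (t, ω) := fun ω => measurable_prodMk_right
  have hf : ∀ ω, IsFiniteMeasure ((M.goals i ω).map fun t => (t, ω)) := fun ω =>
    Measure.isFiniteMeasure_map _ _
  have hp : ∀ (A : Set ℝ≥0) (B : Set Ω), MeasurableSet A → MeasurableSet B →
      Measurable fun ω => (M.goals i ω).map (fun t => (t, ω)) (A ×ˢ B) := by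
    intro A B hA hB
    have h : ∀ ω, (M.goals i ω).map (fun t => (t, ω)) (A ×ˢ B) =
        B.indicator (fun ω => M.goals i ω A) ω := fun ω => by
      rw [Measure.map_apply (hm ω) (hA.prod hB)]
      by_cases hω : ω ∈ B <;> simp [mk_preimage_prod_left, hω]
    simp_rw [h]
    exact ((Measure.measurable_coe hA).comp (measurable_goals i)).indicator hB
  refine Measurable.measure_of_isPiSystem generateFrom_prod.symm isPiSystem_prod ?_ ?_
  · rintro _ ⟨A, hA, B, hB, rfl⟩
    exact hp A B hA hB
  · rw [← univ_prod_univ]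
    exact hp _ _ MeasurableSet.univ MeasurableSet.univ

variable (M Q) in
/-- The measure `dN i ω t Q(dω)`. -/
noncomputable def goalMeasure (i : Fin 2) : Measure (ℝ≥0 × Ω) :=
  Q.bind fun ω => (M.goals i ω).map fun t => (t, ω)

variable (M Q) in
/-- The measure `lam i dt Q(dω)`. -/
noncomputable def compensatorMeasure (i : Fin 2) : Measure (ℝ≥0 × Ω) :=
  M.lam i • (timeMeasure.restrict (Ioc 0 M.T)).prod Q

instance isFiniteMeasure_restrict_timeMeasure (t : ℝ≥0) :
    IsFiniteMeasure (timeMeasure.restrict (Ioc 0 t)) :=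
  ⟨by rw [Measure.restrict_apply_univ, timeMeasure_Ioc]; exact ENNReal.ofReal_lt_top⟩

theorem lintegral_goalMeasure (i : Fin 2) {f : ℝ≥0 × Ω → ℝ≥0∞} (hf : Measurable f) :
    ∫⁻ p, f p ∂M.goalMeasure Q i = ∫⁻ ω, ∫⁻ t, f (t, ω) ∂M.goals i ω ∂Q := by
  rw [goalMeasure, Measure.lintegral_bind (measurable_goals_map i).aemeasurable hf.aemeasurable]
  refine lintegral_congr fun ω => ?_
  rw [lintegral_map hf measurable_prodMk_right]

theorem lintegral_compensatorMeasure [SFinite Q] (i : Fin 2) {f : ℝ≥0 × Ω → ℝ≥0∞}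
    (hf : Measurable f) : ∫⁻ p, f p ∂M.compensatorMeasure Q i =
      ∫⁻ ω, M.lam i * ∫⁻ t in Ioc 0 M.T, f (t, ω) ∂timeMeasure ∂Q := by
  rw [compensatorMeasure, lintegral_smul_measure, lintegral_prod_symm' _ hf,
    lintegral_const_mul _ hf.lintegral_prod_left']
  rfl

theorem goalMeasure_prod (i : Fin 2) {A : Set ℝ≥0} {B : Set Ω} (hA : MeasurableSet A)
    (hB : MeasurableSet B) : M.goalMeasure Q i (A ×ˢ B) = ∫⁻ ω in B, M.goals i ω A ∂Q := by
  rw [← lintegral_indicator_one (hA.prod hB), lintegral_goalMeasure i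
    (measurable_one.indicator (hA.prod hB)), ← lintegral_indicator hB]
  refine lintegral_congr fun ω => ?_
  by_cases hω : ω ∈ B
  · rw [indicator_of_mem hω, ← lintegral_indicator_one hA]
    refine lintegral_congr fun t => ?_
    by_cases ht : t ∈ A <;> simp [ht, hω]
  · simp [hω]

theorem compensatorMeasure_prod [SFinite Q] (i : Fin 2) (A : Set ℝ≥0) (B : Set Ω) :
    M.compensatorMeasure Q i (A ×ˢ B) =
      M.lam i * (timeMeasure.restrict (Ioc 0 M.T) A * Q B) := by
  rw [compensatorMeasure, Measure.smul_apply, Measure.prod_prod]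
  rfl

namespace IsRiskNeutral

theorem integrable_N (hQ : M.IsRiskNeutral Q) (i : Fin 2) (ht : t ≤ M.T) :
    Integrable (fun ω => (M.N i t ω : ℝ)) Q := by
  have := hQ.prob
  have h := ((hQ.martingale_stock i).integrable t).sub
    (integrable_const ((M.lam i : ℝ) * ((M.T : ℝ) - t)))
  refine h.congr (ae_of_all _ fun ω => ?_)
  simp [stock, min_eq_left ht]

theorem setIntegral_N_sub (hQ : M.IsRiskNeutral Q) (i : Fin 2) (hut : u ≤ t)
    (ht : t ≤ M.T) {A : Set Ω} (hA : MeasurableSet[M.filtration u] A) :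
    ∫ ω in A, ((M.N i t ω : ℝ) - M.N i u ω) ∂Q = M.lam i * (t - u) * Q.real A := by
  have := hQ.prob
  have h := (hQ.martingale_stock i).setIntegral_eq hut hA
  simp only [min_eq_left ht, min_eq_left (hut.trans ht), stock] at h
  rw [integral_add (hQ.integrable_N i (hut.trans ht)).integrableOn (integrable_const _),
    integral_add (hQ.integrable_N i ht).integrableOn (integrable_const _), setIntegral_const,
    setIntegral_const, smul_eq_mul, smul_eq_mul] at h
  rw [integral_sub (hQ.integrable_N i ht).integrableOn
    (hQ.integrable_N i (hut.trans ht)).integrableOn]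
  linear_combination -h

theorem lintegral_N_sub (hQ : M.IsRiskNeutral Q) (i : Fin 2) (hut : u ≤ t)
    (ht : t ≤ M.T) {A : Set Ω} (hA : MeasurableSet[M.filtration u] A) :
    ∫⁻ ω in A, ENNReal.ofReal ((M.N i t ω : ℝ) - M.N i u ω) ∂Q =
      M.lam i * (ENNReal.ofReal (t - u) * Q A) := by
  have := hQ.prob
  have hi : Integrable (fun ω => (M.N i t ω : ℝ) - M.N i u ω) Q :=
    (hQ.integrable_N i ht).sub (hQ.integrable_N i (hut.trans ht))
  rw [← ofReal_integral_eq_lintegral_ofReal hi.integrableOn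
    (ae_of_all _ fun ω => sub_nonneg.2 (Nat.cast_le.2 ((M.poisson i).mono ω hut))),
    hQ.setIntegral_N_sub i hut ht hA, mul_assoc, ENNReal.ofReal_mul (M.lam i).coe_nonneg,
    ENNReal.ofReal_mul (sub_nonneg.2 (NNReal.coe_le_coe.2 hut)), ofReal_measureReal]
  simp

theorem goalMeasure_Ioi_prod (hQ : M.IsRiskNeutral Q) (i : Fin 2) (u : ℝ≥0) {A : Set Ω}
    (hA : MeasurableSet[M.filtration u] A) :
    M.goalMeasure Q i (Ioi u ×ˢ A) = M.compensatorMeasure Q i (Ioi u ×ˢ A) := by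
  have := hQ.prob
  rw [goalMeasure_prod i measurableSet_Ioi (M.filtration.le _ _ hA), compensatorMeasure_prod]
  have hI : Ioi u ∩ Ioc 0 M.T = Ioc u M.T := by
    ext s
    simp only [mem_inter_iff, mem_Ioi, mem_Ioc]
    exact ⟨fun h => ⟨h.1, h.2.2⟩, fun h => ⟨h.1, h.1.pos, h.2⟩⟩
  simp_rw [goals, Measure.restrict_apply measurableSet_Ioi, hI]
  rcases le_total u M.T with h | h
  · simp_rw [path_measure_Ioc, timeMeasure_Ioc]
    exact hQ.lintegral_N_sub i h le_rfl hA
  · simp [Ioc_eq_empty_of_le h]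

theorem goalMeasure_bot_prod (hQ : M.IsRiskNeutral Q) (i : Fin 2) {A : Set Ω}
    (hA : MeasurableSet A) :
    M.goalMeasure Q i ({⊥} ×ˢ A) = M.compensatorMeasure Q i ({⊥} ×ˢ A) := by
  have := hQ.prob
  have hI : ({⊥} : Set ℝ≥0) ∩ Ioc 0 M.T = ∅ := by ext s; simp
  rw [goalMeasure_prod i (measurableSet_singleton _) hA, compensatorMeasure_prod]
  simp_rw [goals, Measure.restrict_apply (measurableSet_singleton _), hI]
  simp

/-- The compensator of `N i` is `lam i dt`. -/
theorem trim_goalMeasure (hQ : M.IsRiskNeutral Q) (i : Fin 2) :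
    (M.goalMeasure Q i).trim (predictable_le_prod M.filtration) =
      (M.compensatorMeasure Q i).trim (predictable_le_prod M.filtration) := by
  have := hQ.prob
  have hbot : ∀ A, MeasurableSet[M.filtration ⊥] A →
      (M.goalMeasure Q i).trim (predictable_le_prod M.filtration) ({⊥} ×ˢ A) =
      (M.compensatorMeasure Q i).trim (predictable_le_prod M.filtration) ({⊥} ×ˢ A) :=
    fun A hA => by
      have h := measurableSet_predictable_singleton_bot_prod (𝓕 := M.filtration) hA
      rw [trim_measurableSet_eq _ h, trim_measurableSet_eq _ h]
      exact hQ.goalMeasure_bot_prod i (M.filtration.le _ _ hA)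
  have hIoi : ∀ u A, MeasurableSet[M.filtration u] A →
      (M.goalMeasure Q i).trim (predictable_le_prod M.filtration) (Ioi u ×ˢ A) =
      (M.compensatorMeasure Q i).trim (predictable_le_prod M.filtration) (Ioi u ×ˢ A) :=
    fun u A hA => by
      have h := measurableSet_predictable_Ioi_prod (𝓕 := M.filtration) hA
      rw [trim_measurableSet_eq _ h, trim_measurableSet_eq _ h]
      exact hQ.goalMeasure_Ioi_prod i u hA
  have huniv : (univ : Set (ℝ≥0 × Ω)) = {⊥} ×ˢ univ ∪ Ioi ⊥ ×ˢ univ := by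
    rw [← union_prod, ← univ_prod_univ]
    congr 1
    ext s
    simp
  have hdisj : Disjoint (({⊥} : Set ℝ≥0) ×ˢ (univ : Set Ω)) (Ioi ⊥ ×ˢ univ) := by
    rw [Set.disjoint_prod]
    left
    simp
  have hcf : IsFiniteMeasure (M.compensatorMeasure Q i) := by
    rw [compensatorMeasure]
    infer_instance
  have hcf' : IsFiniteMeasure ((M.compensatorMeasure Q i).trim
      (predictable_le_prod M.filtration)) := isFiniteMeasure_trim _
  -- The uniqueness theorem for measures asks for finiteness of its first argument, which is
  -- immediate for the compensator side.
  symm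
  refine @ext_of_generate_finite _ M.filtration.predictable _ _ _ rfl
    (isPiSystem_predictable M.filtration) hcf' ?_ ?_
  · rintro _ (⟨A, hA, rfl⟩ | ⟨u, A, hA, rfl⟩)
    · exact (hbot A hA).symm
    · exact (hIoi u A hA).symm
  · have hm := measurableSet_predictable_Ioi_prod (𝓕 := M.filtration) (i := ⊥)
      (s := univ) MeasurableSet.univ
    rw [huniv, @measure_union _ M.filtration.predictable _ _ _ hdisj hm,
      @measure_union _ M.filtration.predictable _ _ _ hdisj hm, hbot _ MeasurableSet.univ,
      hIoi _ _ MeasurableSet.univ]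

theorem lintegral_compensator (hQ : M.IsRiskNeutral Q) (i : Fin 2) {f : ℝ≥0 × Ω → ℝ≥0∞}
    (hf : Measurable[M.filtration.predictable] f) :
    ∫⁻ ω, ∫⁻ t, f (t, ω) ∂M.goals i ω ∂Q =
      ∫⁻ ω, M.lam i * ∫⁻ t in Ioc 0 M.T, f (t, ω) ∂timeMeasure ∂Q := by
  have := hQ.prob
  have hf' : Measurable f := hf.mono (predictable_le_prod M.filtration) le_rfl
  rw [← lintegral_goalMeasure i hf', ← lintegral_compensatorMeasure i hf',
    ← lintegral_trim (predictable_le_prod M.filtration) hf, hQ.trim_goalMeasure i,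
    lintegral_trim (predictable_le_prod M.filtration) hf]

end IsRiskNeutral

end BettingMarket

/-! ### Zero expected gains and the conditional expectation of the bet. -/

namespace BettingMarket

variable {Ω : Type*} [MeasurableSpace Ω] {P : Measure Ω} {M : BettingMarket P}
  {Q : Measure Ω} {u t : ℝ≥0} {ω : Ω} {pay : ℕ → ℕ → ℝ}

/-- The `dN`-part and the `dt`-part have the same expectation in `[0, ∞]`. The bound on `H` makes
the `dt`-part, hence both, finite, so they may be subtracted. -/
theorem IsRiskNeutral.integral_stockIntegral_of_nonneg (hQ : M.IsRiskNeutral Q) (i : Fin 2)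
    {H : ℝ≥0 × Ω → ℝ} (hH : Measurable[M.filtration.predictable] H) (h0 : ∀ p, 0 ≤ H p) {C : ℝ}
    (hC : ∀ p, H p ≤ C) :
    Integrable (fun ω => M.stockIntegral i (fun s => H (s, ω)) M.T ω) Q ∧
      ∫ ω, M.stockIntegral i (fun s => H (s, ω)) M.T ω ∂Q = 0 := by
  have := hQ.prob
  have hH' : Measurable H := hH.mono (predictable_le_prod M.filtration) le_rfl
  have hf : Measurable fun p => ENNReal.ofReal (H p) := ENNReal.measurable_ofReal.comp hH'
  set A : Ω → ℝ≥0∞ := fun ω => ∫⁻ s, ENNReal.ofReal (H (s, ω)) ∂M.goals i ω with hA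
  set B : Ω → ℝ≥0∞ := fun ω => M.lam i * ∫⁻ s in Ioc 0 M.T, ENNReal.ofReal (H (s, ω)) ∂timeMeasure
    with hB
  have hAm : Measurable A := by
    have := (Measure.measurable_lintegral hf).comp (measurable_goals_map (M := M) i)
    convert this using 1
    exact funext fun ω => (lintegral_map hf measurable_prodMk_right).symm
  have hBm : Measurable B := hf.lintegral_prod_left'.const_mul _
  have hAB : ∫⁻ ω, A ω ∂Q = ∫⁻ ω, B ω ∂Q :=
    hQ.lintegral_compensator i (ENNReal.measurable_ofReal.comp hH)
  have hBfin : ∫⁻ ω, B ω ∂Q ≠ ∞ := by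
    refine ne_top_of_le_ne_top ?_ (lintegral_mono (g := fun _ =>
      M.lam i * (ENNReal.ofReal C * timeMeasure (Ioc 0 M.T))) fun ω => ?_)
    · rw [lintegral_const, measure_univ, mul_one, timeMeasure_Ioc]
      exact ENNReal.mul_ne_top ENNReal.coe_ne_top
        (ENNReal.mul_ne_top ENNReal.ofReal_ne_top ENNReal.ofReal_ne_top)
    · refine mul_le_mul_right ?_ _
      refine (lintegral_mono fun s => ENNReal.ofReal_le_ofReal (hC (s, ω))).trans_eq ?_
      rw [lintegral_const, Measure.restrict_apply_univ]
  have hAfin : ∫⁻ ω, A ω ∂Q ≠ ∞ := hAB ▸ hBfin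
  have heq : (fun ω => M.stockIntegral i (fun s => H (s, ω)) M.T ω) =
      fun ω => (A ω).toReal - (B ω).toReal := by
    funext ω
    have hs : Measurable fun s => H (s, ω) := hH'.comp measurable_prodMk_right
    rw [stockIntegral, integral_eq_lintegral_of_nonneg_ae (ae_of_all _ fun s => h0 (s, ω))
      hs.aestronglyMeasurable, integral_eq_lintegral_of_nonneg_ae
      (ae_of_all _ fun s => h0 (s, ω)) hs.aestronglyMeasurable, hB, ENNReal.toReal_mul]
    rfl
  have hAi := integrable_toReal_of_lintegral_ne_top hAm.aemeasurable hAfin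
  have hBi := integrable_toReal_of_lintegral_ne_top hBm.aemeasurable hBfin
  rw [heq]
  refine ⟨hAi.sub hBi, ?_⟩
  rw [integral_sub hAi hBi, integral_toReal hAm.aemeasurable (ae_lt_top hAm hAfin),
    integral_toReal hBm.aemeasurable (ae_lt_top hBm hBfin), hAB, sub_self]

/-- Bounded predictable integrands against the stock prices have zero expected gain. -/
theorem IsRiskNeutral.integral_stockIntegral (hQ : M.IsRiskNeutral Q) (i : Fin 2)
    {H : ℝ≥0 × Ω → ℝ} (hH : Measurable[M.filtration.predictable] H) {C : ℝ}
    (hC : ∀ p, |H p| ≤ C) :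
    Integrable (fun ω => M.stockIntegral i (fun s => H (s, ω)) M.T ω) Q ∧
      ∫ ω, M.stockIntegral i (fun s => H (s, ω)) M.T ω ∂Q = 0 := by
  have hH' : Measurable H := hH.mono (predictable_le_prod M.filtration) le_rfl
  -- Shifting by `|C|` makes the integrand nonnegative; the constant integrand is subtracted again.
  have h1 := hQ.integral_stockIntegral_of_nonneg i (H := fun p => H p + |C|)
    (hH.add_const _) (fun p => by linarith [neg_abs_le (H p), hC p, le_abs_self C])
    (C := 2 * |C|) (fun p => by linarith [le_abs_self (H p), hC p, le_abs_self C])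
  have h2 := hQ.integral_stockIntegral_of_nonneg i (H := fun _ => |C|)
    measurable_const (fun p => abs_nonneg C) (fun p => le_rfl)
  have heq : (fun ω => M.stockIntegral i (fun s => H (s, ω)) M.T ω) = fun ω =>
      M.stockIntegral i (fun s => H (s, ω) + |C|) M.T ω
        - M.stockIntegral i (fun _ => |C|) M.T ω := by
    funext ω
    have hs : IntegrableOn (fun s => H (s, ω)) (Ioc 0 M.T) timeMeasure :=
      Integrable.of_bound (hH'.comp measurable_prodMk_right).aestronglyMeasurable C
        (ae_of_all _ fun s => hC (s, ω))
    simp only [stockIntegral]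
    rw [integral_add hs (integrable_const _), integral_add (M.integrableOn_path i _ M.T ω)
      (M.integrableOn_path i _ M.T ω)]
    ring
  rw [heq]
  refine ⟨h1.1.sub h2.1, ?_⟩
  rw [integral_sub h1.1 h2.1, h1.2, h2.2, sub_self]

theorem poissonShift_le_one (k n : ℕ) {a : ℝ} (ha : 0 ≤ a) : poissonShift k n a ≤ 1 := by
  unfold poissonShift poissonProb
  split_ifs
  · have := Real.pow_div_factorial_le_exp a ha (n - k)
    calc _ = Real.exp (-a) * (a ^ (n - k) / (n - k).factorial) := by ring
      _ ≤ Real.exp (-a) * Real.exp a := mul_le_mul_of_nonneg_left this (Real.exp_pos _).le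
      _ = 1 := by rw [← Real.exp_add]; simp
  · exact zero_le_one

theorem trans_le_one (k : Fin 2 → ℕ) (n : ℕ × ℕ) {t : ℝ} (ht : t ≤ M.T) : M.trans k n t ≤ 1 :=
  mul_le_one₀ (poissonShift_le_one _ _ (M.lam_mul_nonneg 0 ht))
    (poissonShift_nonneg _ _ (M.lam_mul_nonneg 1 ht))
    (poissonShift_le_one _ _ (M.lam_mul_nonneg 1 ht))

theorem hasSum_single_trans (n : ℕ × ℕ) (t : ℝ) (k : Fin 2 → ℕ) :
    HasSum (fun m : ℕ × ℕ => (if (m.1, m.2) = n then (1 : ℝ) else 0) * M.trans k m t)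
      (M.trans k n t) := by
  convert hasSum_single n fun m hm => ?_ using 1
  · simp
  · simp [hm]

theorem stockIntegral_indicator (i : Fin 2) (h : ℝ≥0 → ℝ) (t : ℝ≥0)
    (ht : t ≤ M.T) (hi : IntegrableOn h (Ioc 0 M.T) timeMeasure) :
    M.stockIntegral i ((Ioi t).indicator h) M.T ω =
      M.stockIntegral i h M.T ω - M.stockIntegral i h t ω := by
  have hI : Ioc 0 M.T ∩ Ioi t = Ioc t M.T := by
    ext s
    simp only [mem_inter_iff, mem_Ioi, mem_Ioc]
    exact ⟨fun h => ⟨h.2, h.1.2⟩, fun h => ⟨⟨h.1.pos, h.2⟩, h.1⟩⟩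
  have e1 := setIntegral_union (μ := (M.path i ω).measure) (f := h)
    (Ioc_disjoint_Ioc_of_le (a := 0) (d := M.T) (le_refl t)) measurableSet_Ioc
    (M.integrableOn_path i h t ω)
    ((M.integrableOn_path i h M.T ω).mono_set (Ioc_subset_Ioc_left zero_le))
  have e2 := setIntegral_union (μ := timeMeasure) (f := h)
    (Ioc_disjoint_Ioc_of_le (a := 0) (d := M.T) (le_refl t)) measurableSet_Ioc
    (hi.mono_set (Ioc_subset_Ioc_right ht)) (hi.mono_set (Ioc_subset_Ioc_left zero_le))
  rw [Ioc_union_Ioc_eq_Ioc zero_le ht] at e1 e2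
  simp only [stockIntegral]
  rw [setIntegral_indicator measurableSet_Ioi, setIntegral_indicator measurableSet_Ioi, hI, e1, e2]
  ring

theorem measurable_comp_score (f : (Fin 2 → ℕ) → ℝ) (t : ℝ≥0) :
    Measurable[M.filtration t] fun ω => f (M.score t ω) :=
  (measurable_of_countable f).comp (measurable_score t)

theorem measurable_comp_score' (f : (Fin 2 → ℕ) → ℝ) (t : ℝ≥0) :
    Measurable fun ω => f (M.score t ω) :=
  (measurable_comp_score f t).mono (M.filtration.le t) le_rfl

theorem integrable_trans_score [IsFiniteMeasure Q] (n : ℕ × ℕ) (ht : t ≤ M.T) :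
    Integrable (fun ω => M.trans (M.score t ω) n t) Q :=
  Integrable.of_bound (measurable_comp_score' (fun k => M.trans k n t) t).aestronglyMeasurable 1
    (ae_of_all _ fun _ => by
      rw [Real.norm_of_nonneg (M.trans_nonneg _ n (NNReal.coe_le_coe.2 ht))]
      exact trans_le_one _ n (NNReal.coe_le_coe.2 ht))

/-- Under the risk-neutral measure the scores are independent Poisson processes with intensities
`lam i`. -/
theorem IsRiskNeutral.setIntegral_trans [IsProbabilityMeasure P] (hQ : M.IsRiskNeutral Q)
    (n : ℕ × ℕ) (ht : t ≤ M.T) {A : Set Ω} (hA : MeasurableSet[M.filtration t] A) :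
    ∫ ω in A, M.trans (M.score t ω) n t ∂Q =
      ∫ ω in A, (if n = (M.N 0 M.T ω, M.N 1 M.T ω) then 1 else 0) ∂Q := by
  have := hQ.prob
  have hA' := M.filtration.le _ _ hA
  -- The bet paying `1` on the final score `n`: its value function is `trans`, so its hedge ratios
  -- are bounded by `1`.
  set pay : ℕ → ℕ → ℝ := fun a b => if (a, b) = n then 1 else 0 with hpay
  have hval : M.HasValue pay 0 0 := (hasSum_single_trans n _ _).summable
  have hscore : ∀ s k, M.scoreValue pay s k = M.trans k n s := fun s k =>
    (hasSum_single_trans n _ _).tsum_eq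
  set h : Fin 2 → ℝ≥0 → Ω → ℝ := fun i s ω =>
    forwardDiff i (M.scoreValue pay s) (M.scoreBefore s ω) with hh
  -- Hedging only after `t` and only on `A`: the total gain is the increment of the value from `t`
  -- to `T` on `A`, and its expectation is zero.
  set H : Fin 2 → ℝ≥0 × Ω → ℝ := fun i => (Ioc t M.T ×ˢ A).indicator fun p => h i p.1 p.2 with hHdef
  have hbound : ∀ i p, |H i p| ≤ 1 := by
    intro i p
    by_cases hp : p ∈ Ioc t M.T ×ˢ A
    · have hT : (p.1 : ℝ) ≤ M.T := hp.1.2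
      simp only [hHdef, indicator_of_mem hp, hh, forwardDiff, hscore]
      rw [abs_le]
      constructor <;> linarith [M.trans_nonneg (M.scoreBefore p.1 p.2) n hT,
        M.trans_nonneg (M.scoreBefore p.1 p.2 + Pi.single i 1) n hT,
        trans_le_one (M := M) (M.scoreBefore p.1 p.2) n hT,
        trans_le_one (M := M) (M.scoreBefore p.1 p.2 + Pi.single i 1) n hT]
    · simp [hHdef, indicator_of_notMem hp]
  have hmeas : ∀ i, Measurable[M.filtration.predictable] (H i) := by
    intro i
    refine Measurable.indicator (measurable_comp_scoreBefore
      (g := fun s k => forwardDiff i (M.scoreValue pay s) k) fun k => ?_)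
      (measurableSet_predictable_Ioc_prod _ _ hA)
    simp only [forwardDiff, hscore]
    have := fun l => (M.continuous_trans l n).comp NNReal.continuous_coe
    exact ((this _).sub (this _)).measurable
  have hz := fun i => hQ.integral_stockIntegral i (hmeas i) (hbound i)
  have hpath : ∀ᵐ ω ∂Q, A.indicator (fun ω =>
      (if n = (M.N 0 M.T ω, M.N 1 M.T ω) then (1 : ℝ) else 0)
      - M.trans (M.score t ω) n t) ω = M.stockIntegral 0 (fun s => H 0 (s, ω)) M.T ω
        + M.stockIntegral 1 (fun s => H 1 (s, ω)) M.T ω := by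
    filter_upwards [hQ.abs_cont.ae_le M.ae_isSimple] with ω hω
    by_cases hωA : ω ∈ A
    · have hHi : ∀ i, M.stockIntegral i (fun s => H i (s, ω)) M.T ω =
          M.stockIntegral i ((Ioi t).indicator fun s => h i s ω) M.T ω := by
        intro i
        have e : ∀ s ∈ Ioc 0 M.T, H i (s, ω) = (Ioi t).indicator (fun s => h i s ω) s := by
          intro s hs
          by_cases hst : t < s
          · have hp : (s, ω) ∈ Ioc t M.T ×ˢ A := ⟨⟨hst, hs.2⟩, hωA⟩
            simp only [hHdef, indicator_of_mem hp, indicator_of_mem (mem_Ioi.2 hst)]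
          · have hp : (s, ω) ∉ Ioc t M.T ×ˢ A := fun hp => hst hp.1.1
            simp only [hHdef, indicator_of_notMem hp,
              indicator_of_notMem (notMem_Ioi.2 (not_lt.1 hst))]
        simp only [stockIntegral]
        rw [setIntegral_congr_fun measurableSet_Ioc e, setIntegral_congr_fun measurableSet_Ioc e]
      have e1 := hval.scoreValue_eq hω (le_refl M.T)
      have e2 := hval.scoreValue_eq hω ht
      have e3 := fun i => stockIntegral_indicator (ω := ω) i (fun s => h i s ω) t ht
        (hval.integrableOn_hedge i (le_refl M.T) ω)
      rw [indicator_of_mem hωA, hHi, hHi, e3, e3]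
      have hT : (if n = (M.N 0 M.T ω, M.N 1 M.T ω) then (1 : ℝ) else 0) =
          M.trans (M.score M.T ω) n M.T := (trans_T M (M.score M.T ω) n).symm
      rw [hscore] at e1 e2
      simp only [hT, e1, e2, hh]
      ring
    · have hz : ∀ i s, H i (s, ω) = 0 := fun i s => indicator_of_notMem (fun hp => hωA hp.2) _
      simp [hωA, hz, stockIntegral]
  have hind : Integrable (fun ω => (if n = (M.N 0 M.T ω, M.N 1 M.T ω) then (1 : ℝ) else 0)) Q := by
    refine (integrable_trans_score n (le_refl M.T)).congr (ae_of_all _ fun ω => ?_)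
    exact trans_T M _ n
  have hint := integral_congr_ae hpath
  rw [integral_add (hz 0).1 (hz 1).1, (hz 0).2, (hz 1).2, integral_indicator hA',
    integral_sub hind.integrableOn (integrable_trans_score n ht).integrableOn] at hint
  linarith

variable (M) in
/-- The payoff of the bet restricted to the final score `n`. -/
noncomputable def payAt (pay : ℕ → ℕ → ℝ) (n : ℕ × ℕ) (ω : Ω) : ℝ :=
  pay n.1 n.2 * if n = (M.N 0 M.T ω, M.N 1 M.T ω) then 1 else 0

theorem hasSum_payAt (pay : ℕ → ℕ → ℝ) (ω : Ω) :
    HasSum (fun n => M.payAt pay n ω) (M.europeanBet pay ω) := by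
  convert hasSum_single (M.N 0 M.T ω, M.N 1 M.T ω) fun n hn => ?_ using 1
  · simp [payAt, europeanBet]
  · simp [payAt, hn]

theorem integrable_payAt [IsFiniteMeasure Q] (pay : ℕ → ℕ → ℝ) (n : ℕ × ℕ) :
    Integrable (M.payAt pay n) Q := by
  refine ((integrable_trans_score n (le_refl M.T)).const_mul (pay n.1 n.2)).congr
    (ae_of_all _ fun ω => ?_)
  exact congrArg (pay n.1 n.2 * ·) (trans_T M (M.score M.T ω) n)

theorem sum_norm_payAt_le (pay : ℕ → ℕ → ℝ) (s : Finset (ℕ × ℕ)) (ω : Ω) :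
    ∑ n ∈ s, ‖M.payAt pay n ω‖ ≤ ‖M.europeanBet pay ω‖ := by
  have h : ∀ n ∈ s, n ≠ (M.N 0 M.T ω, M.N 1 M.T ω) → ‖M.payAt pay n ω‖ = 0 := fun n _ hn => by
    simp [payAt, hn]
  by_cases hs : (M.N 0 M.T ω, M.N 1 M.T ω) ∈ s
  · rw [Finset.sum_eq_single_of_mem _ hs h]
    simp [payAt, europeanBet]
  · rw [Finset.sum_eq_zero fun n hn => h n hn fun e => hs (e ▸ hn)]
    exact norm_nonneg _

/-- Exactly one final score occurs, so finite sums of norms are bounded by the norm of the bet. -/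
theorem summable_integral_payAt [IsFiniteMeasure Q] (hpay : Integrable (M.europeanBet pay) Q) :
    Summable fun n => ∫ ω, ‖M.payAt pay n ω‖ ∂Q := by
  refine summable_of_sum_le (c := ∫ ω, ‖M.europeanBet pay ω‖ ∂Q)
    (fun n => integral_nonneg fun _ => norm_nonneg _) fun s => ?_
  rw [← integral_finsetSum _ fun n _ => (integrable_payAt pay n).norm]
  exact integral_mono (integrable_finsetSum _ fun n _ => (integrable_payAt pay n).norm)
    hpay.norm fun ω => sum_norm_payAt_le pay s ω

theorem IsRiskNeutral.setIntegral_payAt [IsProbabilityMeasure P] (hQ : M.IsRiskNeutral Q)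
    (pay : ℕ → ℕ → ℝ) (n : ℕ × ℕ) (ht : t ≤ M.T) {A : Set Ω}
    (hA : MeasurableSet[M.filtration t] A) :
    ∫ ω in A, pay n.1 n.2 * M.trans (M.score t ω) n t ∂Q = ∫ ω in A, M.payAt pay n ω ∂Q := by
  unfold payAt
  rw [integral_const_mul, integral_const_mul, hQ.setIntegral_trans n ht hA]

/-- The weights are nonnegative, so this is the identity of expectations for the payoff `|pay|`. It
transfers summability from the terminal time to time `t`. -/
theorem IsRiskNeutral.integral_norm_payAt [IsProbabilityMeasure P] (hQ : M.IsRiskNeutral Q)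
    (pay : ℕ → ℕ → ℝ) (n : ℕ × ℕ) (ht : t ≤ M.T) :
    ∫ ω, ‖pay n.1 n.2 * M.trans (M.score t ω) n t‖ ∂Q = ∫ ω, ‖M.payAt pay n ω‖ ∂Q := by
  have h := hQ.setIntegral_payAt (fun a b => |pay a b|) n ht MeasurableSet.univ
  rw [setIntegral_univ, setIntegral_univ] at h
  convert h using 3 with ω ω
  · rw [norm_mul, Real.norm_of_nonneg (M.trans_nonneg _ n (NNReal.coe_le_coe.2 ht))]
    rfl
  · unfold payAt
    rw [norm_mul]
    split_ifs <;> simp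

/-- At time `0` the score is deterministic, so summability of the expected norms is absolute
convergence of the series itself. -/
theorem IsRiskNeutral.hasValue [IsProbabilityMeasure P] (hQ : M.IsRiskNeutral Q)
    (hpay : Integrable (M.europeanBet pay) Q) : M.HasValue pay 0 0 := by
  have := hQ.prob
  have h := summable_integral_payAt hpay
  simp_rw [← hQ.integral_norm_payAt pay _ (zero_le : 0 ≤ M.T), score_zero] at h
  simp only [integral_const, probReal_univ, one_smul] at h
  exact h.of_norm

theorem IsRiskNeutral.integrable_scoreValue [IsProbabilityMeasure P] (hQ : M.IsRiskNeutral Q)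
    (hpay : Integrable (M.europeanBet pay) Q) (ht : t ≤ M.T) :
    Integrable (fun ω => M.scoreValue pay t (M.score t ω)) Q := by
  have := hQ.prob
  refine integrable_tsum_of_summable_integral
    (fun n => (integrable_trans_score n ht).const_mul _) ?_
  simp_rw [hQ.integral_norm_payAt pay _ ht]
  exact summable_integral_payAt hpay

theorem IsRiskNeutral.setIntegral_scoreValue [IsProbabilityMeasure P] (hQ : M.IsRiskNeutral Q)
    (hpay : Integrable (M.europeanBet pay) Q) (ht : t ≤ M.T) {A : Set Ω}
    (hA : MeasurableSet[M.filtration t] A) :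
    ∫ ω in A, M.scoreValue pay t (M.score t ω) ∂Q = ∫ ω in A, M.europeanBet pay ω ∂Q := by
  have := hQ.prob
  have hle : ∀ {F : ℕ × ℕ → Ω → ℝ}, (∀ n, Integrable (F n) Q) →
      (Summable fun n => ∫ ω, ‖F n ω‖ ∂Q) → Summable fun n => ∫ ω in A, ‖F n ω‖ ∂Q :=
    fun hF hs => Summable.of_nonneg_of_le (fun n => integral_nonneg fun _ => norm_nonneg _)
      (fun n => setIntegral_le_integral (hF n).norm (ae_of_all _ fun _ => norm_nonneg _)) hs
  have hi := fun n : ℕ × ℕ => (integrable_trans_score (Q := Q) n ht).const_mul (pay n.1 n.2)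
  have h1 := hasSum_integral_of_summable_integral_norm (μ := Q.restrict A)
    (fun n => (hi n).integrableOn) (hle hi (by
      simp_rw [hQ.integral_norm_payAt pay _ ht]
      exact summable_integral_payAt hpay))
  have h2 := hasSum_integral_of_summable_integral_norm (μ := Q.restrict A)
    (fun n => (integrable_payAt (M := M) pay n).integrableOn)
    (hle (fun n => integrable_payAt pay n) (summable_integral_payAt hpay))
  simp_rw [hQ.setIntegral_payAt pay _ ht hA] at h1
  simp_rw [(hasSum_payAt pay _).tsum_eq] at h2
  exact h1.unique h2

theorem IsRiskNeutral.condExp_europeanBet [IsProbabilityMeasure P] (hQ : M.IsRiskNeutral Q)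
    (hpay : Integrable (M.europeanBet pay) Q) (ht : t ≤ M.T) :
    Q[M.europeanBet pay | M.filtration t] =ᵐ[Q] fun ω => M.scoreValue pay t (M.score t ω) := by
  have := hQ.prob
  refine (ae_eq_condExp_of_forall_setIntegral_eq (M.filtration.le t) hpay
    (fun A _ _ => (hQ.integrable_scoreValue hpay ht).integrableOn)
    (fun A hA _ => hQ.setIntegral_scoreValue hpay ht hA) ?_).symm
  exact (measurable_comp_score (M.scoreValue pay t) t).stronglyMeasurable.aestronglyMeasurable

/-! ### The hedging strategy and its admissibility. -/

variable (M) in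
/-- The number of stocks `i` that hedges the bet if the score before time `t` is `k`. -/
noncomputable def hedge (pay : ℕ → ℕ → ℝ) (i : Fin 2) (t : ℝ≥0) (k : Fin 2 → ℕ) : ℝ :=
  (Ioc 0 M.T).indicator (fun t => forwardDiff i (M.scoreValue pay t) k) t

variable (M) in
/-- The number of bonds in the hedging portfolio if the score before time `t` is `k`. -/
noncomputable def bondHedge (pay : ℕ → ℕ → ℝ) (t : ℝ≥0) (k : Fin 2 → ℕ) : ℝ :=
  ({0} : Set ℝ≥0).indicator (fun _ => M.scoreValue pay 0 0) t
    + (Ioc 0 M.T).indicator (fun t => M.scoreValue pay t k) t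
    - M.hedge pay 0 t k * (k 0 + M.lam 0 * ((M.T : ℝ) - t))
    - M.hedge pay 1 t k * (k 1 + M.lam 1 * ((M.T : ℝ) - t))

variable (M) in
/-- The hedging strategy of the European bet. -/
noncomputable def hedgingStrategy (pay : ℕ → ℕ → ℝ) (j : Fin 3) (t : ℝ≥0) (ω : Ω) : ℝ :=
  (Fin.cons (M.bondHedge pay) (M.hedge pay) : Fin 3 → ℝ≥0 → (Fin 2 → ℕ) → ℝ) j t
    (M.scoreBefore t ω)

theorem hedgingStrategy_succ (i : Fin 2) (ht0 : 0 < t) (ht : t ≤ M.T) (ω : Ω) :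
    M.hedgingStrategy pay i.succ t ω =
      forwardDiff i (M.scoreValue pay t) (M.scoreBefore t ω) := by
  have : t ∈ Ioc 0 M.T := ⟨ht0, ht⟩
  simp [hedgingStrategy, hedge, this]

/-- At an arbitrary score convergence is known only for positive times, so continuity at `t` is
taken from an intermediate starting time. -/
theorem HasValue.continuousOn_Ioc (h : M.HasValue pay 0 0) (k : Fin 2 → ℕ) :
    ContinuousOn (fun s => M.scoreValue pay s k) (Ioc 0 M.T) := by
  intro t ht
  obtain ⟨s, hs0, hst⟩ := exists_between ht.1
  have hc := (h.of_zero hs0 (hst.le.trans ht.2) k).continuousOn t ⟨hst.le, ht.2⟩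
  refine hc.mono_of_mem_nhdsWithin ?_
  filter_upwards [mem_nhdsWithin_of_mem_nhds (Ioi_mem_nhds hst), self_mem_nhdsWithin] with r hr hr'
  exact ⟨le_of_lt hr, hr'.2⟩

theorem HasValue.measurable_indicator (h : M.HasValue pay 0 0) (k : Fin 2 → ℕ) :
    Measurable ((Ioc 0 M.T).indicator fun s => M.scoreValue pay s k) := by
  classical
  rw [← piecewise_eq_indicator]
  exact (h.continuousOn_Ioc k).measurable_piecewise continuousOn_const measurableSet_Ioc

theorem HasValue.measurable_hedge (h : M.HasValue pay 0 0) (i : Fin 2) (k : Fin 2 → ℕ) :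
    Measurable fun t => M.hedge pay i t k := by
  convert (h.measurable_indicator (k + Pi.single i 1)).sub (h.measurable_indicator k) using 1
  exact indicator_sub _ _ _

theorem HasValue.isStronglyPredictable (h : M.HasValue pay 0 0) (j : Fin 3) :
    IsStronglyPredictable M.filtration (M.hedgingStrategy pay j) := by
  refine (measurable_comp_scoreBefore (g := fun t k => (Fin.cons (M.bondHedge pay) (M.hedge pay) :
    Fin 3 → ℝ≥0 → (Fin 2 → ℕ) → ℝ) j t k) fun k => ?_).stronglyMeasurable
  refine Fin.cases ?_ (fun i => ?_) j
  · have h0 := h.measurable_hedge 0 k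
    have h1 := h.measurable_hedge 1 k
    have h2 := h.measurable_indicator k
    simp only [Fin.cons_zero, bondHedge]
    have h3 : Measurable fun t : ℝ≥0 =>
      ({0} : Set ℝ≥0).indicator (fun _ => M.scoreValue pay 0 0) t :=
      measurable_const.indicator (measurableSet_singleton 0)
    fun_prop
  · simpa using h.measurable_hedge i k

theorem HasValue.integrableOn_hedgingStrategy (h : M.HasValue pay 0 0) (j : Fin 3) (ω : Ω) :
    IntegrableOn (fun t => M.hedgingStrategy pay j t ω) (Iic M.T) timeMeasure := by
  have hI : Ioc 0 M.T =ᵐ[timeMeasure] Iic M.T := by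
    have : Iic M.T = Icc 0 M.T := by ext; simp
    rw [this]
    exact Ioc_ae_eq_Icc
  refine IntegrableOn.congr_set_ae ?_ hI.symm
  have hsucc : ∀ i : Fin 2, IntegrableOn (fun t => M.hedge pay i t (M.scoreBefore t ω))
      (Ioc 0 M.T) timeMeasure := fun i =>
    (h.integrableOn_hedge i (le_refl M.T) ω).congr_fun (fun s hs => by
      simp [hedge, indicator_of_mem hs]) measurableSet_Ioc
  refine Fin.cases ?_ (fun i => ?_) j
  · have h1 : IntegrableOn (fun t => M.scoreValue pay t (M.scoreBefore t ω)) (Ioc 0 M.T)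
        timeMeasure :=
      integrableOn_scoreBefore (f := fun s => M.scoreValue pay s)
        (fun _ _ hut ht => (h.of_score (hut.trans ht) ω).integrableOn hut ht) le_rfl
    have h2 : ∀ i : Fin 2, IntegrableOn (fun t : ℝ≥0 => M.hedge pay i t (M.scoreBefore t ω)
        * ((M.scoreBefore t ω i : ℝ) + M.lam i * ((M.T : ℝ) - t))) (Ioc 0 M.T) timeMeasure := by
      intro i
      have hc : Continuous fun t : ℝ≥0 => (M.lam i : ℝ) * ((M.T : ℝ) - t) := by fun_prop
      have := integrableOn_scoreBefore (ω := ω) (t := M.T)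
        (f := fun s k => forwardDiff i (M.scoreValue pay s) k
          * ((k i : ℝ) + M.lam i * ((M.T : ℝ) - s))) (fun u t hut ht =>
            IntegrableOn.mul_continuousOn_of_subset
              ((h.of_score (hut.trans ht) ω).integrableOn_forwardDiff hut ht i)
              (hc.const_add _).continuousOn measurableSet_Ioc isCompact_Icc Ioc_subset_Icc_self)
        le_rfl
      refine this.congr_fun (fun s hs => ?_) measurableSet_Ioc
      simp only [hedge, indicator_of_mem hs]
    have h3 := ((h1.sub (h2 0)).sub (h2 1))
    refine h3.congr_fun (fun s hs => ?_) measurableSet_Ioc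
    simp [hedgingStrategy, bondHedge, indicator_of_mem hs, hs.1.ne']
  · simpa [hedgingStrategy] using hsucc i

theorem value_hedgingStrategy (hω : M.IsSimple ω) (ht : t ≤ M.T) :
    M.value (M.hedgingStrategy pay) t ω = M.scoreValue pay t (M.score t ω) := by
  have e1 : (1 : Fin 3) = Fin.succ 0 := rfl
  have e2 : (2 : Fin 3) = Fin.succ 1 := rfl
  rcases eq_or_ne t 0 with rfl | h0
  · have hz : ∀ i : Fin 2, M.hedgingStrategy pay i.succ 0 ω = 0 := fun i => by
      simp [hedgingStrategy, hedge]
    rw [value, e1, e2, hz, hz]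
    simp [hedgingStrategy, hedge, bondHedge, score_zero]
  have ht0 := pos_iff_ne_zero.2 h0
  have hm : t ∈ Ioc 0 M.T := ⟨ht0, ht⟩
  have hN : ∀ i, M.N i t ω = M.score t ω i := fun i => rfl
  rw [value, e1, e2, hedgingStrategy_succ 0 ht0 ht, hedgingStrategy_succ 1 ht0 ht]
  simp only [hedgingStrategy, Fin.cons_zero, bondHedge, hedge, indicator_of_mem hm,
    indicator_of_notMem (show t ∉ ({0} : Set ℝ≥0) from h0), stock, hN]
  -- The bonds are set from the score before `t`, so the value is `X(t, N_{t-})` plus hedge ratio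
  -- times jump. For at most one goal this is `X(t, N_t)`.
  rcases hω t ht0 ht with h1 | ⟨i, h1⟩
  · rw [h1]
    ring
  · rw [h1]
    rcases Fin.exists_fin_two.1 ⟨i, rfl⟩ with rfl | rfl <;>
    · simp [forwardDiff]
      ring

theorem stockIntegral_hedgingStrategy (i : Fin 2) (ht : t ≤ M.T) (ω : Ω) :
    M.stockIntegral i (fun s => M.hedgingStrategy pay i.succ s ω) t ω =
      M.stockIntegral i (fun s => forwardDiff i (M.scoreValue pay s) (M.scoreBefore s ω)) t ω := by
  have e : ∀ s ∈ Ioc 0 t, M.hedgingStrategy pay i.succ s ω =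
      forwardDiff i (M.scoreValue pay s) (M.scoreBefore s ω) := fun s hs =>
    hedgingStrategy_succ i hs.1 (hs.2.trans ht) ω
  simp only [stockIntegral]
  rw [setIntegral_congr_fun measurableSet_Ioc e, setIntegral_congr_fun measurableSet_Ioc e]

theorem IsRiskNeutral.isMartingaleOnGame [IsProbabilityMeasure P] (hQ : M.IsRiskNeutral Q)
    (hpay : Integrable (M.europeanBet pay) Q) {Y : ℝ≥0 → Ω → ℝ}
    (hadp : StronglyAdapted M.filtration Y)
    (hY : ∀ t ≤ M.T, Y t =ᵐ[Q] fun ω => M.scoreValue pay t (M.score t ω)) :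
    M.IsMartingaleOnGame Y Q := by
  have := hQ.prob
  have hY' : ∀ t ≤ M.T, Y t =ᵐ[Q] Q[M.europeanBet pay | M.filtration t] := fun t ht =>
    (hY t ht).trans (hQ.condExp_europeanBet hpay ht).symm
  have hadp' : StronglyAdapted M.filtration fun t => Y (min t M.T) := fun t =>
    (hadp _).mono (M.filtration.mono (min_le_left _ _))
  refine ⟨hadp', fun i j hij => ?_⟩
  rcases le_total i M.T with hi | hi
  · simp only [min_eq_left hi]
    exact (condExp_congr_ae (hY' _ (min_le_right j M.T))).trans
      ((condExp_condExp_of_le (M.filtration.mono (le_min hij hi)) (M.filtration.le _)).trans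
        (hY' i hi).symm)
  -- After `T` the stopped process is constant in time.
  · simp only [min_eq_right hi, min_eq_right (hi.trans hij)]
    rw [condExp_of_stronglyMeasurable (M.filtration.le i) ((hadp _).mono (M.filtration.mono hi))]
    exact integrable_condExp.congr (hY' _ le_rfl).symm

theorem stronglyAdapted_value {φ : Fin 3 → ℝ≥0 → Ω → ℝ}
    (hφ : ∀ j, IsStronglyPredictable M.filtration (φ j)) :
    StronglyAdapted M.filtration (M.value φ) := by
  have hS : ∀ i t, StronglyMeasurable[M.filtration t] (M.stock i t) := fun i t =>
    (measurable_comp_score (fun k => (k i : ℝ) + M.lam i * ((M.T : ℝ) - t)) t).stronglyMeasurable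
  intro t
  exact ((((hφ 0).stronglyAdapted t).mul_const 1).add
    (((hφ 1).stronglyAdapted t).mul (hS 0 t))).add (((hφ 2).stronglyAdapted t).mul (hS 1 t))

theorem IsRiskNeutral.replicates_hedgingStrategy [IsProbabilityMeasure P]
    (hQ : M.IsRiskNeutral Q) (hpay : Integrable (M.europeanBet pay) Q) :
    M.Replicates Q (M.hedgingStrategy pay) (M.europeanBet pay) := by
  have h := hQ.hasValue hpay
  refine ⟨⟨h.isStronglyPredictable, fun j => ae_of_all _ (h.integrableOn_hedgingStrategy j)⟩,
    ?_, hQ.isMartingaleOnGame hpay (stronglyAdapted_value h.isStronglyPredictable) ?_, ?_⟩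
  · filter_upwards [M.ae_isSimple] with ω hω t ht
    have e0 := stockIntegral_hedgingStrategy (pay := pay) 0 ht ω
    have e1 := stockIntegral_hedgingStrategy (pay := pay) 1 ht ω
    rw [value_hedgingStrategy hω ht, value_hedgingStrategy hω zero_le, score_zero,
      h.scoreValue_eq hω ht, ← e0, ← e1]
    rfl
  · intro t ht
    filter_upwards [hQ.abs_cont.ae_le M.ae_isSimple] with ω hω
    exact value_hedgingStrategy hω ht
  · filter_upwards [M.ae_isSimple] with ω hω
    rw [value_hedgingStrategy hω le_rfl, scoreValue_T]
    rfl

end BettingMarket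

/-! ### Uniqueness of the stock holdings. -/

theorem continuousOn_setIntegral_timeMeasure {f : ℝ≥0 → ℝ} {T : ℝ≥0}
    (hf : IntegrableOn f (Ioc 0 T) timeMeasure) :
    ContinuousOn (fun t => ∫ s in Ioc 0 t, f s ∂timeMeasure) (Iic T) := by
  set μ : Measure ℝ := timeMeasure.map ((↑) : ℝ≥0 → ℝ) with hμ
  have hna : NullSingletonClass μ := by
    rw [hμ, timeMeasure, measurableEmbedding_nnreal_coe.map_comap]
    infer_instance
  have hpre : ∀ t : ℝ≥0, ((↑) : ℝ≥0 → ℝ) ⁻¹' Ioc 0 (t : ℝ) = Ioc 0 t := fun t => by ext; simp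
  have hcomp : (fun x : ℝ => f x.toNNReal) ∘ ((↑) : ℝ≥0 → ℝ) = f := by ext; simp
  have hint : IntegrableOn (fun x : ℝ => f x.toNNReal) (Icc 0 T) μ := by
    rw [integrableOn_Icc_iff_integrableOn_Ioc, hμ,
      measurableEmbedding_nnreal_coe.integrableOn_map_iff, hpre, hcomp]
    exact hf
  have h := intervalIntegral.continuousOn_primitive hint
  have e : ∀ t : ℝ≥0, ∫ s in Ioc 0 t, f s ∂timeMeasure = ∫ x in Ioc 0 (t : ℝ), f x.toNNReal ∂μ := by
    intro t
    rw [hμ, measurableEmbedding_nnreal_coe.setIntegral_map, hpre]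
    simp
  simp_rw [e]
  exact h.comp NNReal.continuous_coe.continuousOn fun t ht => ⟨t.2, NNReal.coe_le_coe.2 ht⟩

namespace BettingMarket

variable {Ω : Type*} [MeasurableSpace Ω] {P : Measure Ω} {M : BettingMarket P}
  {Q : Measure Ω} {u t : ℝ≥0} {ω : Ω} {pay : ℕ → ℕ → ℝ}

theorem setIntegral_path_sub_of_const (hut : u ≤ t)
    (hc : ∀ s ∈ Ico u t, M.score s ω = M.score u ω) (i : Fin 2) (f : ℝ≥0 → ℝ) :
    ∫ s in Ioc 0 t, f s ∂(M.path i ω).measure = (∫ s in Ioc 0 u, f s ∂(M.path i ω).measure)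
      + ((M.N i t ω : ℝ) - M.N i u ω) * f t := by
  rcases hut.eq_or_lt with rfl | h
  · simp
  rw [← integral_path_of_const h hc, ← setIntegral_union (Ioc_disjoint_Ioc_of_le le_rfl)
    measurableSet_Ioc (M.integrableOn_path i f u ω)
    ((M.integrableOn_path i f t ω).mono_set (Ioc_subset_Ioc_left zero_le)),
    Ioc_union_Ioc_eq_Ioc zero_le hut]

/-- If the gains from trading vanish on a dense set of times, they do not jump. -/
theorem eq_zero_of_isGoalTime (hω : M.IsSimple ω) {ψ : Fin 2 → ℝ≥0 → ℝ}
    (hψ : ∀ i, IntegrableOn (ψ i) (Ioc 0 M.T) timeMeasure) {D : Set ℝ≥0} (hD : Dense D)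
    (hzero : ∀ q, (q ∈ D ∨ q = M.T) → q ≤ M.T →
      M.stockIntegral 0 (ψ 0) q ω + M.stockIntegral 1 (ψ 1) q ω = 0)
    {i : Fin 2} (ht0 : 0 < t) (ht : t ≤ M.T) (hi : M.IsGoalTime i t ω) : ψ i t = 0 := by
  -- The gain splits as `J - K`, with `J` a step function changing only at goals and `K` continuous
  -- on the game.
  set J : ℝ≥0 → ℝ := fun t => (∫ s in Ioc 0 t, ψ 0 s ∂(M.path 0 ω).measure)
    + ∫ s in Ioc 0 t, ψ 1 s ∂(M.path 1 ω).measure with hJ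
  set K : ℝ≥0 → ℝ := fun t => M.lam 0 * (∫ s in Ioc 0 t, ψ 0 s ∂timeMeasure)
    + M.lam 1 * ∫ s in Ioc 0 t, ψ 1 s ∂timeMeasure with hK
  have hKc : ContinuousOn K (Iic M.T) :=
    ((continuousOn_setIntegral_timeMeasure (hψ 0)).const_mul _).add
      ((continuousOn_setIntegral_timeMeasure (hψ 1)).const_mul _)
  have hq : ∀ q, (q ∈ D ∨ q = M.T) → q ≤ M.T → K q = J q := by
    intro q hq hqT
    have := hzero q hq hqT
    simp only [stockIntegral] at this
    simp only [hJ, hK]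
    linarith
  have hJc : ∀ u t, u ≤ t → (∀ s ∈ Ico u t, M.score s ω = M.score u ω) →
      J t = J u + (((M.N 0 t ω : ℝ) - M.N 0 u ω) * ψ 0 t
        + ((M.N 1 t ω : ℝ) - M.N 1 u ω) * ψ 1 t) := by
    intro u t hut hc
    simp only [hJ]
    rw [setIntegral_path_sub_of_const hut hc, setIntegral_path_sub_of_const hut hc]
    ring
  have hJc' : ∀ u t, u ≤ t → (∀ s ∈ Icc u t, M.score s ω = M.score u ω) → J t = J u := by
    intro u t hut hc
    rw [hJc u t hut fun s hs => hc s ⟨hs.1, hs.2.le⟩]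
    have h := hc t ⟨hut, le_rfl⟩
    have h0 : M.N 0 t ω = M.N 0 u ω := congrFun h 0
    have h1 : M.N 1 t ω = M.N 1 u ω := congrFun h 1
    simp [h0, h1]
  -- Times of `D` just after `t` determine both sides, by continuity of `K` and local constancy of
  -- `J` to the right. At `T` no later time of the game exists, hence the separate hypothesis.
  have hKJ : ∀ t ≤ M.T, K t = J t := by
    intro t ht
    rcases ht.eq_or_lt with rfl | htT
    · exact hq _ (Or.inr rfl) le_rfl
    obtain ⟨v, hv, hc⟩ := M.exists_score_eq_right t ω
    have hlim : Tendsto K (𝓝[>] t) (𝓝 (K t)) := by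
      refine (hKc t ht).tendsto.mono_left (nhdsWithin_le_of_mem ?_)
      filter_upwards [Ioc_mem_nhdsGT htT] with s hs using hs.2
    refine mem_singleton_iff.1 (isClosed_singleton.mem_of_frequently_of_tendsto ?_ hlim)
    refine Filter.Frequently.mono (p := fun s => s ∈ D ∧ s ∈ Ioo t (min v M.T)) ?_ ?_
    · have h1 : ∃ᶠ s in 𝓝[>] t, s ∈ D := by
        rw [frequently_iff]
        intro U hU
        obtain ⟨w, hw, hwU⟩ := mem_nhdsGT_iff_exists_Ioo_subset.1 hU
        obtain ⟨q, hqD, hq⟩ := hD.exists_between (mem_Ioi.1 hw)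
        exact ⟨q, hwU hq, hqD⟩
      exact h1.and_eventually (Ioo_mem_nhdsGT (lt_min hv htT))
    · rintro s ⟨hsD, hts, hs⟩
      have hsv := hs.trans_le (min_le_left _ _)
      rw [mem_singleton_iff, hq s (Or.inl hsD) (hs.le.trans (min_le_right _ _))]
      exact hJc' t s hts.le fun r hr => hc r ⟨hr.1, hr.2.trans_lt hsv⟩
  obtain ⟨u, hu, hc⟩ := M.exists_score_eq_left ht0 ω
  have hne : (𝓝[<] t).NeBot := nhdsLT_neBot_of_exists_lt ⟨u, hu⟩
  have hlim : Tendsto K (𝓝[<] t) (𝓝 (K t)) := by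
    refine (hKc t ht).tendsto.mono_left (nhdsWithin_mono _ fun s hs => ?_)
    exact (le_of_lt hs).trans ht
  -- Approaching `t` from the left gives the value of `J` before the goal, so the jump of `J` at `t`
  -- is zero.
  have hKu : K t = J u := by
    refine tendsto_nhds_unique hlim (tendsto_const_nhds.congr' ?_)
    filter_upwards [Ioo_mem_nhdsLT hu] with s hs
    rw [hKJ s (hs.2.le.trans ht)]
    exact (hJc' u s hs.1.le fun r hr => hc r ⟨hr.1, hr.2.trans_lt hs.2⟩).symm
  have hjump := hJc u t hu.le hc
  rw [← hKJ t ht, hKu] at hjump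
  have hb := scoreBefore_eq hc (s := t) ⟨hu, le_rfl⟩
  have hN : ∀ i, M.N i t ω = M.score t ω i := fun i => rfl
  have hN' : ∀ i, M.N i u ω = M.scoreBefore t ω i := fun i => by rw [hb]; rfl
  simp only [hN, hN'] at hjump
  unfold IsGoalTime at hi
  rcases hω t ht0 ht with h | ⟨j, h⟩
  · exact absurd (congrFun h i) hi
  · rw [h] at hjump hi
    -- Only one team scores at `t`, so the vanishing jump consists of the single term `ψ i t`.
    rcases Fin.exists_fin_two.1 ⟨i, rfl⟩ with rfl | rfl <;>
    rcases Fin.exists_fin_two.1 ⟨j, rfl⟩ with rfl | rfl <;>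
    simp at hjump hi ⊢ <;> exact hjump

theorem ae_scoreBefore_eq_score (t : ℝ≥0) (ω : Ω) :
    ∀ᵐ s ∂timeMeasure.restrict (Ioc 0 t), M.scoreBefore s ω = M.score s ω := by
  refine M.path_induction (ω := ω)
    (Pr := fun u t => ∀ᵐ s ∂timeMeasure.restrict (Ioc u t), M.scoreBefore s ω = M.score s ω)
    (by simp) ?_ ?_ t
  · intro u v t huv hvt h1 h2
    rw [← Ioc_union_Ioc_eq_Ioc huv hvt, ae_restrict_union_iff]
    exact ⟨h1, h2⟩
  · intro u t hut hc
    rw [ae_restrict_iff' measurableSet_Ioc]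
    filter_upwards [measure_eq_zero_iff_ae_notMem.1 (timeMeasure_singleton t)] with s hs hsI
    rw [scoreBefore_eq hc hsI, hc s ⟨hsI.1.le, lt_of_le_of_ne hsI.2 hs⟩]

/-- Admissibility enters uniqueness here: a martingale is determined by its terminal value. -/
theorem Replicates.value_eq (hQ : M.IsRiskNeutral Q) {φ : Fin 3 → ℝ≥0 → Ω → ℝ} {X : Ω → ℝ}
    (hφ : M.Replicates Q φ X) (ht : t ≤ M.T) : M.value φ t =ᵐ[Q] Q[X | M.filtration t] := by
  have h := hφ.martingale.2 t M.T ht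
  simp only [min_eq_left ht, min_self] at h
  exact h.symm.trans (condExp_congr_ae (hQ.abs_cont.ae_le hφ.terminal))

theorem IsTradingStrategy.integrableOn {φ : Fin 3 → ℝ≥0 → Ω → ℝ}
    (hφ : M.IsTradingStrategy φ) : ∀ᵐ ω ∂P, ∀ j,
      IntegrableOn (fun t => φ j t ω) (Ioc 0 M.T) timeMeasure := by
  filter_upwards [ae_all_iff.2 hφ.integrable] with ω hω j
  exact (hω j).mono_set fun s hs => hs.2

theorem stockIntegral_sub {f g : ℝ≥0 → ℝ} (hf : IntegrableOn f (Ioc 0 M.T) timeMeasure)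
    (hg : IntegrableOn g (Ioc 0 M.T) timeMeasure) (i : Fin 2) (ht : t ≤ M.T) (ω : Ω) :
    M.stockIntegral i (fun s => f s - g s) t ω =
      M.stockIntegral i f t ω - M.stockIntegral i g t ω := by
  simp only [stockIntegral]
  rw [integral_sub (M.integrableOn_path i f t ω) (M.integrableOn_path i g t ω),
    integral_sub (hf.mono_set (Ioc_subset_Ioc_right ht)) (hg.mono_set (Ioc_subset_Ioc_right ht))]
  ring

/-- Two strategies that replicate the same bet hold the same stocks when goals are scored. -/
theorem Replicates.ae_eq_of_isGoalTime [IsProbabilityMeasure P] (hQ : M.IsRiskNeutral Q)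
    {φ φ' : Fin 3 → ℝ≥0 → Ω → ℝ} {X : Ω → ℝ} (hφ : M.Replicates Q φ X)
    (hφ' : M.Replicates Q φ' X) : ∀ᵐ ω ∂P, ∀ (i : Fin 2) (t : ℝ≥0), 0 < t → t ≤ M.T →
      M.IsGoalTime i t ω → φ i.succ t ω = φ' i.succ t ω := by
  obtain ⟨D, hDc, hD⟩ := TopologicalSpace.exists_countable_dense ℝ≥0
  have hval : ∀ t ≤ M.T, M.value φ t =ᵐ[P] M.value φ' t := fun t ht =>
    hQ.abs_cont'.ae_le ((hφ.value_eq hQ ht).trans (hφ'.value_eq hQ ht).symm)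
  -- The exceptional null set depends on the time, so only countably many times are used.
  have hall : ∀ᵐ ω ∂P, ∀ q ∈ insert M.T D, q ≤ M.T → M.value φ q ω = M.value φ' q ω := by
    rw [ae_ball_iff (hDc.insert _)]
    intro q _
    by_cases hqT : q ≤ M.T
    · filter_upwards [hval q hqT] with ω hω _ using hω
    · exact ae_of_all _ fun ω h => absurd h hqT
  filter_upwards [M.ae_isSimple, hall, hval 0 zero_le, hφ.selfFinancing, hφ'.selfFinancing,
    hφ.strategy.integrableOn, hφ'.strategy.integrableOn] with ω hω hq h0 hsf hsf' hi hi'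
  intro i t ht0 ht hgoal
  refine sub_eq_zero.1 (eq_zero_of_isGoalTime hω
    (ψ := fun i s => φ i.succ s ω - φ' i.succ s ω) (fun i => (hi _).sub (hi' _)) hD
    (fun q hqD hqT => ?_) ht0 ht hgoal)
  have e := hq q (hqD.elim (mem_insert_of_mem _) fun h => h ▸ mem_insert _ _) hqT
  rw [hsf q hqT, hsf' q hqT, h0] at e
  rw [stockIntegral_sub (hi _) (hi' _) 0 hqT, stockIntegral_sub (hi _) (hi' _) 1 hqT]
  change M.value φ' 0 ω + M.stockIntegral 0 (fun s => φ (Fin.succ 0) s ω) q ω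
    + M.stockIntegral 1 (fun s => φ (Fin.succ 1) s ω) q ω = M.value φ' 0 ω
    + M.stockIntegral 0 (fun s => φ' (Fin.succ 0) s ω) q ω
    + M.stockIntegral 1 (fun s => φ' (Fin.succ 1) s ω) q ω at e
  linarith

/-- Two strategies that replicate the same bet hold the same stocks at almost all times. -/
theorem Replicates.ae_ae_eq [IsProbabilityMeasure P] (hQ : M.IsRiskNeutral Q)
    {φ φ' : Fin 3 → ℝ≥0 → Ω → ℝ} {X : Ω → ℝ} (hφ : M.Replicates Q φ X)
    (hφ' : M.Replicates Q φ' X) (i : Fin 2) :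
    ∀ᵐ ω ∂P, ∀ᵐ t ∂timeMeasure.restrict (Ioc 0 M.T), φ i.succ t ω = φ' i.succ t ω := by
  have hm : Measurable[M.filtration.predictable] fun p : ℝ≥0 × Ω =>
      φ i.succ p.1 p.2 - φ' i.succ p.1 p.2 :=
    (hφ.strategy.predictable i.succ).measurable.sub (hφ'.strategy.predictable i.succ).measurable
  set f : ℝ≥0 × Ω → ℝ≥0∞ := fun p => ‖φ i.succ p.1 p.2 - φ' i.succ p.1 p.2‖ₑ with hf
  have hfm : Measurable[M.filtration.predictable] f := measurable_enorm.comp hm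
  have hfm' : Measurable f := hfm.mono (predictable_le_prod M.filtration) le_rfl
  -- The measure `dN i` charges only goal times, where the holdings agree. As `f` is predictable,
  -- the compensator turns this into a vanishing `dt`-integral, and `lam i > 0` can be cancelled.
  have h1 : ∫⁻ ω, ∫⁻ t, f (t, ω) ∂M.goals i ω ∂Q = 0 := by
    refine lintegral_eq_zero_of_ae_eq_zero ?_
    filter_upwards [hQ.abs_cont.ae_le (hφ.ae_eq_of_isGoalTime hQ hφ')] with ω hω
    refine lintegral_eq_zero_of_ae_eq_zero ?_
    have := M.ae_path_isGoalTime i M.T ω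
    rw [ae_restrict_iff' measurableSet_Ioc] at this
    refine (ae_restrict_iff' measurableSet_Ioc).2 ?_
    filter_upwards [this] with t ht htI
    simp [hf, hω i t htI.1 htI.2 (ht htI)]
  have := hQ.prob
  rw [hQ.lintegral_compensator i hfm, lintegral_eq_zero_iff
    (hfm'.lintegral_prod_left'.const_mul _)] at h1
  refine hQ.abs_cont'.ae_le ?_
  filter_upwards [h1] with ω hω
  have hlam : (M.lam i : ℝ≥0∞) ≠ 0 := ENNReal.coe_ne_zero.2 (M.lam_pos i).ne'
  have h2 := (mul_eq_zero.1 hω).resolve_left hlam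
  have hfs : Measurable fun t => f (t, ω) := hfm'.comp measurable_prodMk_right
  rw [lintegral_eq_zero_iff hfs] at h2
  filter_upwards [h2] with t ht
  simpa [hf, sub_eq_zero] using ht

theorem HasValue.forwardDiff_europeanValue (h : M.HasValue pay 0 0) (i : Fin 2) (ht0 : 0 < t)
    (ht : t ≤ M.T) (k : Fin 2 → ℕ) : forwardDiff i (M.europeanValue pay t) k =
      forwardDiff i (M.scoreValue pay t) k := by
  simp only [forwardDiff, (h.of_zero ht0 ht _).europeanValue_eq]

end BettingMarket

/-! ### The proposition on portfolio weights. -/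

theorem mainTheorem4 {Ω : Type*} [MeasurableSpace Ω] (P : Measure Ω) [IsProbabilityMeasure P]
    (M : BettingMarket P) (Q : Measure Ω) (hQ : M.IsRiskNeutral Q)
    (pay : ℕ → ℕ → ℝ) (hpay : Integrable (M.europeanBet pay) Q) :
    -- the time-`t` value of the bet is `X(t, N t)`
    (∀ t ≤ M.T, Q[M.europeanBet pay | M.filtration t]
        =ᵐ[Q] fun ω => M.europeanValue pay t (M.score t ω)) ∧
    -- there is a replicating strategy with stock components `δ i X(t, N (t-))`
    (∃ φ : Fin 3 → ℝ≥0 → Ω → ℝ, M.Replicates Q φ (M.europeanBet pay) ∧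
      ∀ (i : Fin 2) (t : ℝ≥0) (ω : Ω), 0 < t → t ≤ M.T →
        φ i.succ t ω =
          BettingMarket.forwardDiff i (M.europeanValue pay t) (M.scoreBefore t ω)) ∧
    -- the stock components of every replicating strategy are `δ i X(t, N t)`
    (∀ φ : Fin 3 → ℝ≥0 → Ω → ℝ, M.Replicates Q φ (M.europeanBet pay) →
      ∀ i : Fin 2,
        (∀ᵐ ω ∂P, ∀ᵐ t ∂timeMeasure, t ≤ M.T →
          φ i.succ t ω =
            BettingMarket.forwardDiff i (M.europeanValue pay t) (M.score t ω)) ∧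
        (∀ᵐ ω ∂P, ∀ t : ℝ≥0, 0 < t → t ≤ M.T → M.IsGoalTime i t ω →
          φ i.succ t ω =
            BettingMarket.forwardDiff i (M.europeanValue pay t) (M.scoreBefore t ω))) := by
  have hval := hQ.hasValue hpay
  have hrep := hQ.replicates_hedgingStrategy hpay
  have hdiff : ∀ (i : Fin 2) (t : ℝ≥0) (ω : Ω), 0 < t → t ≤ M.T →
      M.hedgingStrategy pay i.succ t ω =
        BettingMarket.forwardDiff i (M.europeanValue pay t) (M.scoreBefore t ω) :=
    fun i t ω ht0 ht => (BettingMarket.hedgingStrategy_succ i ht0 ht ω).trans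
      (hval.forwardDiff_europeanValue i ht0 ht _).symm
  refine ⟨fun t ht => ?_, ⟨M.hedgingStrategy pay, hrep, hdiff⟩, fun φ hφ i => ⟨?_, ?_⟩⟩
  · refine (hQ.condExp_europeanBet hpay ht).trans (ae_of_all _ fun ω => ?_)
    exact (hval.of_score ht ω).europeanValue_eq.symm
  · filter_upwards [hφ.ae_ae_eq hQ hrep i] with ω hω
    have hscore := BettingMarket.ae_scoreBefore_eq_score (M := M) M.T ω
    rw [ae_restrict_iff' measurableSet_Ioc] at hω hscore
    -- Time `0` is discarded as a null set, because the holdings there are not determined by the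
    -- replication argument.
    filter_upwards [hω, hscore, measure_eq_zero_iff_ae_notMem.1 (timeMeasure_singleton 0)]
      with t h1 h2 h3 ht
    have ht0 : 0 < t := pos_iff_ne_zero.2 h3
    rw [h1 ⟨ht0, ht⟩, hdiff i t ω ht0 ht, h2 ⟨ht0, ht⟩]
  · filter_upwards [hφ.ae_eq_of_isGoalTime hQ hrep] with ω hω t ht0 ht hgoal
    rw [hω i t ht0 ht hgoal, hdiff i t ω ht0 ht]
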